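/- Let $L=\{L_1,\dots,L_n\}$ form a T-graph on the torus $\mathbb R^2/\mathbb Z^2$, i.e. the $L_i$ ("complete edges") are pairwise disjoint (embedded) open line segments in the torus whose union is closed. *The graphs.* The vertices of $\mathcal G_T$ are the endpoints of the $L_i$. These points cut each $L_i$ into *subsegments* (the undirected edges of $\mathcal G_T$). Each vertex $v$ lies in the interior of exactly one $L_i$ and has exactly two outgoing directed edges, along the two subsegments of $L_i$ adjacent to $v$; their weights are inversely proportional to their lengths and add up to $1$. The vertices of the undirected dual graph $\mathcal G_T'$ are the faces, i.e. the connected components of the complement of $\bigcup_i L_i$ in the torus, and each subsegment $S$ gives an edge $S^*$ of $\mathcal G_T'$ joining the faces on its two sides (loops and multiple edges are allowed). $\mathcal G_D$ is the bipartite multigraph with white vertices the faces and black vertices the complete edges, with one edge $e$ between a face $\phi$ and $L_i$ for each maximal portion $S_e$ of a side of $L_i$ bordered by $\phi$; its weight is the length $|S_e|$. A perfect matching $M$ of $\mathcal G_D$ has weight $\nu(M)=\prod_{e\in M}|S_e|$. A *marked* perfect matching $M'$ is a perfect matching $M$ together with a subsegment $S'_e\subset S_e$ for every $e\in M$; its weight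 is $\nu(M')=\prod_{e\in M}|S'_e|$. *Forests.* An in-directed cycle-rooted spanning forest (CRSF) of $\mathcal G_T$ (respectively $\mathcal G_T'$) is a set of directed edges of $\mathcal G_T$ (respectively of edges of $\mathcal G_T'$, each with a direction) such that exactly one edge goes out of each vertex and no directed cycle is null-homotopic, i.e. none lifts to a closed path in the universal cover $\mathbb R^2$. A CRSF $F$ of $\mathcal G_T$ and a CRSF $F'$ of $\mathcal G_T'$ are dual if the subsegments used by $F$ are exactly those not crossed by $F'$. The weight of $F$ is the product of the weights of its edges; the weight of $F'$ is $\prod_{S^*\in F'}|S|$. **Theorem.** There are finitely many marked perfect matchings of $\mathcal G_D$. The map sending a marked perfect matching $M'$ to the set $F'_{M'}$ of dual edges $(S'_e)^*$, $e\in M$, each directed away from the face matched by $e$ (starting from the side of the complete edge on which $S_e$ lies), is a bijection from the marked perfect matchings of $\mathcal G_D$ onto the in-directed CRSFs $F'$ of $\mathcal G_T'$ that are dual to some in-directed CRSF $F$ of $\mathcal G_T$. It preserves weights: the weight of $F'_{M'}$ is $\nu(M')$, and there is a constant $c>0$, depending only on $L$, such that every in-directed CRSF $F$ of $\mathcal G_T$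 dual to $F'_{M'}$ has weight $c\,\nu(M')$. In particular each perfect matching $M$ corresponds to the set of forests $F'_{M'}$ with $M'$ a marking of $M$, and $\nu(M)$ is the sum of the weights of these forests. -/

import Mathlib

open scoped Topology

noncomputable section

namespace TGraph

/-- The Euclidean plane, the universal cover of the torus. -/
abbrev Plane : Type := EuclideanSpace ℝ (Fin 2)

/-- The torus `ℝ² / ℤ²`. -/
abbrev Torus : Type := UnitAddTorus (Fin 2)

/-- The covering map `ℝ² → ℝ² / ℤ²`. -/
def proj (x : Plane) : Torus := fun k => (x k : UnitAddCircle)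

/-- A vector of the lattice `ℤ²`, as a vector of the plane. -/
def latticeVec (z : Fin 2 → ℤ) : Plane := WithLp.toLp 2 fun k => (z k : ℝ)

/-- The determinant of two plane vectors; it is positive iff `v` points to the left of `u`. -/
def cross (u v : Plane) : ℝ := u 0 * v 1 - u 1 * v 0

/-- The two sides of an oriented line: `true` is left, `false` is right. -/
def sideSign (σ : Bool) : ℝ := if σ then 1 else -1

/-- A T-graph on the torus: a finite disjoint collection of open line segments in `ℝ² / ℤ²` whose
union is closed. The `i`-th complete edge is the (injective) image under the covering map of the open
plane segment from `a i` to `b i`. -/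
structure TorusTGraph (n : ℕ) where
  a : Fin n → Plane
  b : Fin n → Plane
  ne : ∀ i, a i ≠ b i
  inj : ∀ i, Set.InjOn proj (openSegment ℝ (a i) (b i))
  disj : ∀ i j, i ≠ j →
    Disjoint (proj '' openSegment ℝ (a i) (b i)) (proj '' openSegment ℝ (a j) (b j))
  closed : IsClosed (⋃ i, proj '' openSegment ℝ (a i) (b i))

namespace TorusTGraph

variable {n : ℕ} (L : TorusTGraph n)

/-- The union of the complete edges, in the torus. -/
def support : Set Torus := ⋃ i, proj '' openSegment ℝ (L.a i) (L.b i)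

/-- The point with parameter `r` on the chosen lift of the `i`-th complete edge
(`r = 0` is `a i`, `r = 1` is `b i`). -/
def pt (i : Fin n) (r : ℝ) : Plane := AffineMap.lineMap (L.a i) (L.b i) r

/-- The vertices of `𝒢_T`: the points of the torus that are endpoints of some complete edge. -/
def vertexSet : Set Torus := {v | ∃ i, v = proj (L.a i) ∨ v = proj (L.b i)}

/-- The vertices of `𝒢_T`, as a type. -/
def Vertex : Type := {v : Torus // v ∈ L.vertexSet}

/-- The parameters at which the closure of the `i`-th complete edge meets a vertex of `𝒢_T`. -/
def breaks (i : Fin n) : Set ℝ := {r | r ∈ Set.Icc (0 : ℝ) 1 ∧ proj (L.pt i r) ∈ L.vertexSet}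

/-- A subsegment of a complete edge: the part between two consecutive vertices of `𝒢_T` on (the
closure of) that complete edge. These are the undirected edges of `𝒢_T`. -/
structure Subsegment where
  idx : Fin n
  lo : ℝ
  hi : ℝ
  lt : lo < hi
  lo_mem : lo ∈ L.breaks idx
  hi_mem : hi ∈ L.breaks idx
  consecutive : ∀ r ∈ Set.Ioo lo hi, r ∉ L.breaks idx

/-- The Euclidean length of a subsegment. -/
def Subsegment.length {L : TorusTGraph n} (S : L.Subsegment) : ℝ :=
  (S.hi - S.lo) * dist (L.a S.idx) (L.b S.idx)

/-! ### The directed graph `𝒢_T` -/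

/-- A directed edge of `𝒢_T`: a subsegment of a complete edge, directed away from one of its two
ends (the lower one if `fwd`), which has to be an interior point of that complete edge. -/
structure TEdge where
  seg : L.Subsegment
  fwd : Bool
  interior : (if fwd then seg.lo else seg.hi) ∈ Set.Ioo (0 : ℝ) 1

namespace TEdge

variable {L}

/-- The starting point of a directed edge, on the chosen lift of its complete edge. -/
def tailPt (d : L.TEdge) : Plane := L.pt d.seg.idx (if d.fwd then d.seg.lo else d.seg.hi)

/-- The end point of a directed edge, on the chosen lift of its complete edge. -/
def headPt (d : L.TEdge) : Plane := L.pt d.seg.idx (if d.fwd then d.seg.hi else d.seg.lo)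

/-- The vertex of `𝒢_T` at which a directed edge starts. -/
def src (d : L.TEdge) : L.Vertex :=
  ⟨proj d.tailPt, by
    unfold tailPt
    split
    · exact d.seg.lo_mem.2
    · exact d.seg.hi_mem.2⟩

/-- The transition probability of a directed edge: inversely proportional to its length, and
normalized so that the weights of the edges going out of a vertex add up to one. -/
def weight (d : L.TEdge) : ℝ :=
  d.seg.length⁻¹ / ∑ᶠ (d' : L.TEdge) (_ : d'.src = d.src), d'.seg.length⁻¹

/-- Some lift of the directed edge `d` to the universal cover goes from `x` to `y`. -/
def Lift (d : L.TEdge) (x y : Plane) : Prop :=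
  ∃ z : Fin 2 → ℤ, x = d.tailPt + latticeVec z ∧ y = d.headPt + latticeVec z

end TEdge

/-! ### Faces and the dual graph `𝒢_T'` -/

/-- The faces of `𝒢_T`: the connected components of the complement of the complete edges. -/
def Face : Type :=
  {φ : Set Torus // ∃ p ∈ L.supportᶜ, φ = connectedComponentIn L.supportᶜ p}

/-- The faces of the periodic lift of the T-graph to the universal cover. -/
def LiftedFace : Type :=
  {P : Set Plane // ∃ x ∈ (proj ⁻¹' L.support)ᶜ,
    P = connectedComponentIn (proj ⁻¹' L.support)ᶜ x}

/-- All points close to `x` which lie strictly on side `σ` of the line through `x` parallel to the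
`i`-th complete edge are in `A`. -/
def Beside (A : Set Plane) (i : Fin n) (σ : Bool) (x : Plane) : Prop :=
  ∀ᶠ y in 𝓝 x, 0 < sideSign σ * cross (L.b i - L.a i) (y - x) → y ∈ A

/-- The (parameters of) points of the `i`-th complete edge which the face `φ` borders from side
`σ`. -/
def sideSet (φ : L.Face) (i : Fin n) (σ : Bool) : Set ℝ :=
  {r | r ∈ Set.Ioo (0 : ℝ) 1 ∧ L.Beside (proj ⁻¹' φ.1) i σ (L.pt i r)}

/-- A directed edge of `𝒢_T'`: it crosses the subsegment `seg`, from the face `src` bordering `seg`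
on the side `side` to the face `dst` bordering `seg` on the other side. -/
structure DualDart where
  seg : L.Subsegment
  side : Bool
  src : L.Face
  dst : L.Face
  src_spec : Set.Ioo seg.lo seg.hi ⊆ L.sideSet src seg.idx side
  dst_spec : Set.Ioo seg.lo seg.hi ⊆ L.sideSet dst seg.idx (!side)

/-- Some lift of the dual edge `d` to the universal cover goes from the lifted face `P` to the lifted
face `Q`. -/
def DualDart.Lift {L : TorusTGraph n} (d : L.DualDart) (P Q : L.LiftedFace) : Prop :=
  ∃ z : Fin 2 → ℤ, ∀ r ∈ Set.Ioo d.seg.lo d.seg.hi,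
    L.Beside P.1 d.seg.idx d.side (L.pt d.seg.idx r + latticeVec z) ∧
    L.Beside Q.1 d.seg.idx (!d.side) (L.pt d.seg.idx r + latticeVec z)

/-! ### Cycle-rooted spanning forests -/

/-- In-directed cycle-rooted spanning forests of a directed graph on the torus with vertex type `V`,
edge type `E` and lifted vertex type `X`; `lift e x y` says that some lift of `e` goes from `x` to
`y`. A set `F` of directed edges is such a forest if exactly one edge of `F` goes out of every vertex
and if no directed cycle of `F` is null-homotopic, that is, the lift of `F` has no directed cycle. -/
def IsCRSF {V E X : Type} (src : E → V) (lift : E → X → X → Prop) (F : Finset E) : Prop :=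
  (∀ v, ∃! e, e ∈ F ∧ src e = v) ∧
    ∀ x, ¬ Relation.TransGen (fun x y => ∃ e ∈ F, lift e x y) x x

/-- `F` is an in-directed cycle-rooted spanning forest of `𝒢_T`. -/
def IsForest (F : Finset L.TEdge) : Prop := IsCRSF TEdge.src TEdge.Lift F

/-- `F'` is an in-directed cycle-rooted spanning forest of `𝒢_T'`. -/
def IsDualForest (F' : Finset L.DualDart) : Prop := IsCRSF DualDart.src DualDart.Lift F'

/-- `F` and `F'` are dual: the subsegments used by `F` are those which `F'` does not cross. -/
def AreDual (F : Finset L.TEdge) (F' : Finset L.DualDart) : Prop :=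
  ∀ S : L.Subsegment, (∃ d ∈ F, d.seg = S) ↔ ¬ ∃ d ∈ F', d.seg = S

/-- The in-directed cycle-rooted spanning forests of `𝒢_T'` whose dual is (the set of edges of) an
in-directed cycle-rooted spanning forest of `𝒢_T`. -/
def GoodDualForest : Type :=
  {F' : Finset L.DualDart // L.IsDualForest F' ∧ ∃ F, L.IsForest F ∧ L.AreDual F F'}

/-- The weight of a forest of `𝒢_T`: the product of its transition probabilities. -/
def forestWeight {L : TorusTGraph n} (F : Finset L.TEdge) : ℝ := ∏ d ∈ F, d.weight

/-- The weight of a forest of `𝒢_T'`: the product of the lengths of the subsegments it crosses. -/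
def dualForestWeight {L : TorusTGraph n} (F' : Finset L.DualDart) : ℝ := ∏ d ∈ F', d.seg.length

/-! ### The dimer graph `𝒢_D` -/

/-- An edge of `𝒢_D`, joining the face `face` to the complete edge `idx`: a maximal portion (the one
between the parameters `lo` and `hi`) of that complete edge which the face borders from side
`side`. A face may share several such portions with one complete edge, and each is an edge. -/
structure DimerEdge where
  face : L.Face
  idx : Fin n
  side : Bool
  lo : ℝ
  hi : ℝ
  lt : lo < hi
  borders : Set.Ioo lo hi ⊆ L.sideSet face idx side
  lo_max : lo ∉ L.sideSet face idx side
  hi_max : hi ∉ L.sideSet face idx side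

/-- The weight of an edge of `𝒢_D`: the Euclidean length of the shared portion. -/
def DimerEdge.weight {L : TorusTGraph n} (e : L.DimerEdge) : ℝ :=
  (e.hi - e.lo) * dist (L.a e.idx) (L.b e.idx)

/-- Perfect matchings of `𝒢_D`. -/
def PerfectMatching : Type :=
  {M : Finset L.DimerEdge //
    (∀ φ : L.Face, ∃! e, e ∈ M ∧ e.face = φ) ∧ (∀ i : Fin n, ∃! e, e ∈ M ∧ e.idx = i)}

/-- The weight of a perfect matching. -/
def PerfectMatching.weight {L : TorusTGraph n} (M : L.PerfectMatching) : ℝ :=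
  ∏ e ∈ M.1, e.weight

/-- A marking of a perfect matching: for each of its edges, one of the subsegments of the portion
that is this edge. -/
def Marking {L : TorusTGraph n} (M : L.PerfectMatching) : Type :=
  {m : {e // e ∈ M.1} → L.Subsegment //
    ∀ e, (m e).idx = e.1.idx ∧ e.1.lo ≤ (m e).lo ∧ (m e).hi ≤ e.1.hi}

/-- Marked perfect matchings of `𝒢_D`. -/
def MarkedMatching : Type := Σ M : L.PerfectMatching, Marking M

/-- The weight of a marked matching: the product of the lengths of its marked subsegments. -/
def MarkedMatching.weight {L : TorusTGraph n} (M' : L.MarkedMatching) : ℝ :=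
  ∏ e ∈ M'.1.1.attach, (M'.2.1 e).length

/-- The directed edges of `𝒢_T'` given by a marked matching: each marked subsegment, crossed away
from the face with which its complete edge is matched. -/
def MarkedMatching.darts {L : TorusTGraph n} (M' : L.MarkedMatching) : Set L.DualDart :=
  {d | ∃ e : {e // e ∈ M'.1.1}, d.src = e.1.face ∧ d.side = e.1.side ∧ d.seg = M'.2.1 e}

end TorusTGraph

end TGraph

end

open scoped Topology

noncomputable section

namespace TGraph

/-! ### Winding numbers of closed polygonal paths -/

/-! The count behind the bijection: a complete edge with `k` vertices in its interior has `k + 1`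
subsegments. A forest `F` of `𝒢_T` leaves each of these vertices along one adjacent subsegment, and
never uses a subsegment twice, since going back and forth is a null-homotopic cycle. So `F` leaves
exactly one subsegment of each complete edge unused (`IsForest.exists_unique_unused`). A dual `F'`
crosses exactly these subsegments, each once, and leaves each face once: this is a perfect matching
of faces with complete edges, together with a marking.

Conversely, a marking determines a candidate for `F`: along each complete edge, move away from the
marked subsegment (`awayForest`). What has to be proved is that neither this candidate nor the set
of darts of the matching has a null-homotopic cycle. This is an infinite descent in the universal
cover. A closed path of `F` has nonzero winding number around some lifted faces; the dart leaving
such a face cannot cross the path, so it ends in another enclosed face, and finiteness gives a cycle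
of `F'` among enclosed faces (`Complementary.exists_dual_cycle`). Symmetrically, a closed path
following `F'` encloses a lifted vertex, which `F` leaves without crossing the path, giving a cycle
of `F` among enclosed vertices (`Complementary.exists_cycle`). After both steps the cycle lies in a
strictly smaller disc, while only finitely many lifted vertices lie in a disc
(`Complementary.no_bounded_cycle`). Winding numbers, as sums of viewing angles, replace the Jordan
curve theorem.

For the weights, each subsegment is either used once by `F` or crossed once by `F'`, so the product
of inverse lengths over `F` is a constant times the product of lengths over `F'`; the normalizing
factors at the vertices depend on `L` only. Finally, the length of a dimer edge is the sum of the
lengths of its subsegments, and expanding the product of these sums runs over all markings. -/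

/-- The plane, identified with the complex numbers. -/
def toC : Plane ≃ₗᵢ[ℝ] ℂ := Complex.orthonormalBasisOneI.repr.symm

/-- The rotation of the plane by a right angle, counterclockwise. -/
def rot (v : Plane) : Plane := toC.symm (Complex.I * toC v)

theorem toC_apply (v : Plane) : toC v = v 0 + v 1 * Complex.I := by
  have h := Complex.orthonormalBasisOneI.sum_repr_symm v
  rw [Fin.sum_univ_two] at h
  simp only [Complex.orthonormalBasisOneI, Complex.coe_basisOneI,
    Module.Basis.coe_toOrthonormalBasis, Matrix.cons_val_zero, Matrix.cons_val_one,
    Complex.real_smul, mul_one] at h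
  exact h.symm

theorem toC_rot (v : Plane) : toC (rot v) = Complex.I * toC v := by simp [rot]

theorem rot_apply_zero (v : Plane) : rot v 0 = -v 1 := by
  have h := toC_rot v
  rw [toC_apply, toC_apply] at h
  simpa using congrArg Complex.re h

theorem rot_apply_one (v : Plane) : rot v 1 = v 0 := by
  have h := toC_rot v
  rw [toC_apply, toC_apply] at h
  simpa using congrArg Complex.im h

/-- The angle under which the segment from `p` to `q` is seen from `x`. -/
def viewAngle (p q x : Plane) : ℝ := (toC (q - x) / toC (p - x)).arg

/-- The total angle under which a polygonal path, given as a list of edges, is seen from `x`. -/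
def winding (l : List (Plane × Plane)) (x : Plane) : ℝ :=
  (l.map fun e => viewAngle e.1 e.2 x).sum

/-- The edges in the list `l` form a polygonal path from `a` to `b`. -/
def IsPath : Plane → List (Plane × Plane) → Plane → Prop
  | a, [], b => a = b
  | a, e :: l, b => e.1 = a ∧ IsPath e.2 l b

theorem winding_nil (x : Plane) : winding [] x = 0 := rfl

theorem winding_cons (e : Plane × Plane) (l : List (Plane × Plane)) (x : Plane) :
    winding (e :: l) x = viewAngle e.1 e.2 x + winding l x := by
  simp [winding]

theorem exists_path_of_reflTransGen {R : Plane → Plane → Prop} {a b : Plane}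
    (h : Relation.ReflTransGen R a b) : ∃ l, IsPath a l b ∧ ∀ e ∈ l, R e.1 e.2 := by
  induction h using Relation.ReflTransGen.head_induction_on with
  | refl => exact ⟨[], rfl, by simp⟩
  | head h _ ih =>
    obtain ⟨l, hl, hR⟩ := ih
    refine ⟨(_, _) :: l, ⟨rfl, hl⟩, ?_⟩
    simp only [List.mem_cons, forall_eq_or_imp]
    exact ⟨h, hR⟩

theorem coe_viewAngle {p q x : Plane} (hp : p ≠ x) (hq : q ≠ x) :
    (viewAngle p q x : Real.Angle) = (toC (q - x)).arg - (toC (p - x)).arg := by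
  have h1 : toC (q - x) ≠ 0 := by simpa [sub_eq_zero] using hq
  have h2 : toC (p - x) ≠ 0 := by simpa [sub_eq_zero] using hp
  rw [viewAngle, Complex.arg_div_coe_angle h1 h2]

/-- Modulo `2π` each viewing angle is a difference of arguments, and the sum along the path
telescopes. -/
theorem coe_winding {a b x : Plane} {l : List (Plane × Plane)} (hl : IsPath a l b)
    (hx : ∀ e ∈ l, x ∉ segment ℝ e.1 e.2) :
    (winding l x : Real.Angle) = (toC (b - x)).arg - (toC (a - x)).arg := by
  induction l generalizing a with
  | nil => obtain rfl : a = b := hl; simp [winding_nil]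
  | cons e l ih =>
    obtain ⟨rfl, hl⟩ := hl
    simp only [List.mem_cons, forall_eq_or_imp] at hx
    rw [winding_cons, Real.Angle.coe_add, ih hl hx.2, coe_viewAngle]
    · abel
    · rintro h; exact hx.1 (h ▸ left_mem_segment ℝ _ _)
    · rintro h; exact hx.1 (h ▸ right_mem_segment ℝ _ _)

theorem winding_mem_zmultiples {a x : Plane} {l : List (Plane × Plane)} (hl : IsPath a l a)
    (hx : ∀ e ∈ l, x ∉ segment ℝ e.1 e.2) :
    winding l x ∈ AddSubgroup.zmultiples (2 * Real.pi) := by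
  have h := coe_winding hl hx
  rw [sub_self, Real.Angle.coe_eq_zero_iff] at h
  exact h

/-- The quotient is a nonpositive real only if `q - x` and `p - x` point in opposite directions or
one of them vanishes, which puts `x` on the segment. So `arg` is continuous wherever the viewing
angle is used. -/
theorem div_mem_slitPlane {p q x : Plane} (hx : x ∉ segment ℝ p q) :
    toC (q - x) / toC (p - x) ∈ Complex.slitPlane := by
  by_contra h
  rw [Complex.mem_slitPlane_iff_not_le_zero, not_not] at h
  obtain ⟨s, hs, hs'⟩ : ∃ s : ℝ, 0 ≤ s ∧ toC (q - x) / toC (p - x) = -(s : ℂ) := by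
    obtain ⟨h1, h2⟩ := Complex.le_def.1 h
    refine ⟨-(toC (q - x) / toC (p - x)).re, by simpa using h1, ?_⟩
    apply Complex.ext
    · simp
    · simpa using h2
  have hp : toC (p - x) ≠ 0 := by
    intro h0
    have : p = x := by simpa [sub_eq_zero] using h0
    exact hx (this ▸ left_mem_segment ℝ _ _)
  rw [div_eq_iff hp] at hs'
  have h3 : q - x = -(s • (p - x)) := by
    apply toC.injective
    rw [hs', map_neg, map_smul, Complex.real_smul, neg_mul]
  apply hx
  have hs1 : (1 + s) ≠ 0 := by positivity
  -- Solving `q - x = -s (p - x)` for `x` gives these barycentric weights.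
  refine ⟨s / (1 + s), 1 / (1 + s), by positivity, by positivity, by field_simp; ring, ?_⟩
  have h4 : q = x - s • (p - x) := by rw [eq_sub_iff_add_eq, ← sub_eq_zero, ← sub_eq_zero.2 h3]; abel
  rw [h4]
  ext k
  simp
  field_simp
  ring

theorem continuousAt_viewAngle {p q x : Plane} (hx : x ∉ segment ℝ p q) :
    ContinuousAt (viewAngle p q) x := by
  have hp : toC (p - x) ≠ 0 := by
    intro h0
    have : p = x := by simpa [sub_eq_zero] using h0
    exact hx (this ▸ left_mem_segment ℝ _ _)
  refine ContinuousAt.comp (g := Complex.arg) (Complex.continuousAt_arg (div_mem_slitPlane hx)) ?_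
  refine ContinuousAt.div ?_ ?_ hp
  · exact (toC.continuous.comp (continuous_const.sub continuous_id)).continuousAt
  · exact (toC.continuous.comp (continuous_const.sub continuous_id)).continuousAt

theorem continuousAt_winding {x : Plane} {l : List (Plane × Plane)}
    (hx : ∀ e ∈ l, x ∉ segment ℝ e.1 e.2) : ContinuousAt (winding l) x := by
  induction l with
  | nil => exact continuousAt_const
  | cons e l ih =>
    simp only [List.mem_cons, forall_eq_or_imp] at hx
    have : winding (e :: l) = fun x => viewAngle e.1 e.2 x + winding l x := by
      ext x; exact winding_cons e l x
    rw [this]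
    exact (continuousAt_viewAngle hx.1).add (ih hx.2)

/-- The winding number is constant on connected sets disjoint from the closed path. -/
theorem winding_eq_of_isPreconnected {a : Plane} {l : List (Plane × Plane)} (hl : IsPath a l a)
    {A : Set Plane} (hA : IsPreconnected A) (hx : ∀ x ∈ A, ∀ e ∈ l, x ∉ segment ℝ e.1 e.2)
    {x y : Plane} (hxA : x ∈ A) (hyA : y ∈ A) : winding l x = winding l y := by
  -- The winding angle of a closed path is continuous with values in the discrete group `2πℤ`.
  refine hA.constant_of_mapsTo (T := (AddSubgroup.zmultiples (2 * Real.pi) : Set ℝ)) ?_ ?_ ?_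
    hxA hyA
  · have := NormedSpace.discreteTopology_zmultiples (2 * Real.pi)
    exact ⟨this⟩
  · exact fun x hx' => (continuousAt_winding (hx x hx')).continuousWithinAt
  · exact fun x hx' => winding_mem_zmultiples hl (hx x hx')

theorem isClosed_segment (p q : Plane) : IsClosed (segment ℝ p q) := by
  rw [segment_eq_image_lineMap]
  exact (isCompact_Icc.image AffineMap.lineMap_continuous).isClosed

theorem eventually_notMem_path {x : Plane} {l : List (Plane × Plane)}
    (hx : ∀ e ∈ l, x ∉ segment ℝ e.1 e.2) : ∀ᶠ y in 𝓝 x, ∀ e ∈ l, y ∉ segment ℝ e.1 e.2 := by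
  induction l with
  | nil => simp
  | cons e l ih =>
    simp only [List.mem_cons, forall_eq_or_imp] at hx ⊢
    filter_upwards [(isClosed_segment _ _).isOpen_compl.mem_nhds hx.1, ih hx.2] with y h1 h2
    exact ⟨h1, h2⟩

theorem eventually_winding_eq {a x : Plane} {l : List (Plane × Plane)} (hl : IsPath a l a)
    (hx : ∀ e ∈ l, x ∉ segment ℝ e.1 e.2) : ∀ᶠ y in 𝓝 x, winding l y = winding l x := by
  obtain ⟨ε, hε, hb⟩ := Metric.eventually_nhds_iff_ball.1 (eventually_notMem_path hx)
  filter_upwards [Metric.ball_mem_nhds x hε] with y hy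
  exact winding_eq_of_isPreconnected hl (convex_ball x ε).isPreconnected hb hy
    (Metric.mem_ball_self hε)

/-- Both arguments lie in `(-π/2, π/2)`, so their difference needs no correction by `2π`. -/
theorem arg_div_of_re_pos {u v : ℂ} (hu : 0 < u.re) (hv : 0 < v.re) :
    (u / v).arg = u.arg - v.arg := by
  have hu0 : u ≠ 0 := by rintro rfl; simp at hu
  have hv0 : v ≠ 0 := by rintro rfl; simp at hv
  have h1 := abs_lt.1 (Complex.abs_arg_lt_pi_div_two_iff.2 (Or.inl hu))
  have h2 := abs_lt.1 (Complex.abs_arg_lt_pi_div_two_iff.2 (Or.inl hv))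
  have h3 : v⁻¹.arg = -v.arg := by
    rw [Complex.arg_inv, if_neg]
    intro h; linarith [h2.2, Real.pi_pos]
  rw [div_eq_mul_inv, Complex.arg_mul hu0 (inv_ne_zero hv0), h3, sub_eq_add_neg]
  rw [h3]
  constructor <;> linarith [h1.1, h1.2, h2.1, h2.2]

/-- Seen from a far point `x`, and after division by `-x`, all corners lie in the right half-plane,
where arguments subtract exactly. The sum therefore telescopes in `ℝ` and not only modulo `2π`; for
a closed path it is zero. -/
theorem winding_of_norm_lt {a b x : Plane} {l : List (Plane × Plane)} (hl : IsPath a l b)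
    {R : ℝ} (ha : ‖a‖ ≤ R) (hR : ∀ e ∈ l, ‖e.2‖ ≤ R) (hx : R < ‖x‖) :
    winding l x = (toC (b - x) / toC (-x)).arg - (toC (a - x) / toC (-x)).arg := by
  have key : ∀ p : Plane, ‖p‖ ≤ R → 0 < (toC (p - x) / toC (-x)).re := by
    intro p hp
    have hx0 : toC x ≠ 0 := by
      intro h
      rw [← norm_eq_zero, LinearIsometryEquiv.norm_map] at h
      linarith [norm_nonneg p]
    have h1 : toC (p - x) / toC (-x) = 1 - toC p / toC x := by
      rw [map_sub, map_neg]; field_simp; ring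
    have h2 : ‖toC p / toC x‖ < 1 := by
      rw [norm_div, LinearIsometryEquiv.norm_map, LinearIsometryEquiv.norm_map, div_lt_one]
      · linarith
      · linarith [norm_nonneg p]
    rw [h1, Complex.sub_re, Complex.one_re]
    linarith [Complex.re_le_norm (toC p / toC x)]
  have hx0 : toC (-x) ≠ 0 := by
    intro h
    rw [← norm_eq_zero, LinearIsometryEquiv.norm_map, norm_neg] at h
    linarith [norm_nonneg a]
  induction l generalizing a with
  | nil => obtain rfl : a = b := hl; simp [winding_nil]
  | cons e l ih =>
    obtain ⟨rfl, hl⟩ := hl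
    simp only [List.mem_cons, forall_eq_or_imp] at hR
    rw [winding_cons, ih hl hR.1 hR.2, viewAngle,
      ← div_div_div_cancel_right₀ hx0, arg_div_of_re_pos (key _ hR.1) (key _ ha)]
    ring

/-- A closed path winds only around points closer to the origin than its farthest point. -/
theorem norm_lt_of_winding_ne_zero {a x : Plane} {l : List (Plane × Plane)} (hl : IsPath a l a)
    (hx : ∀ e ∈ l, x ∉ segment ℝ e.1 e.2) {R : ℝ} (ha : ‖a‖ ≤ R) (hR : ∀ e ∈ l, ‖e.2‖ ≤ R)
    (hw : winding l x ≠ 0) : ‖x‖ < R := by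
  by_contra hxR
  rw [not_lt] at hxR
  rcases eq_or_ne x 0 with rfl | hx0
  · have hR0 : R ≤ 0 := by simpa using hxR
    cases l with
    | nil => exact hw rfl
    | cons e l =>
      have : e.2 = 0 := norm_le_zero_iff.1 ((hR e (by simp)).trans hR0)
      exact hx e (by simp) (this ▸ right_mem_segment ℝ _ _)
  · apply hw
    -- To include the case `‖x‖ = R`, push `x` slightly outwards, which does not change the winding.
    have hc : Filter.Tendsto (fun t : ℝ => (1 + t) • x) (𝓝[>] 0) (𝓝 x) := by
      have : ContinuousAt (fun t : ℝ => (1 + t) • x) 0 := by fun_prop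
      have h := this.tendsto
      simp only [add_zero, one_smul] at h
      exact h.mono_left nhdsWithin_le_nhds
    obtain ⟨t, ht, ht0⟩ :=
      ((hc.eventually (eventually_winding_eq hl hx)).and self_mem_nhdsWithin).exists
    rw [← ht, winding_of_norm_lt hl ha hR, sub_self]
    have ht0 : 0 < t := ht0
    rw [norm_smul, Real.norm_of_nonneg (by positivity)]
    have : 0 < ‖x‖ := norm_pos_iff.2 hx0
    nlinarith

/-- In the complex coordinate centred at `c` with unit `v`, the edge runs from `-s` to `s` and the
observer stands at `t i`. -/
theorem viewAngle_symm_edge (c v : Plane) (hv : v ≠ 0) {s : ℝ} (t : ℝ) :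
    viewAngle (c - s • v) (c + s • v) (c + t • rot v) =
      (-(((s : ℂ) - t * Complex.I) / (s + t * Complex.I))).arg := by
  have hv0 : toC v ≠ 0 := by simpa using hv
  have h1 : c + s • v - (c + t • rot v) = s • v - t • rot v := by abel
  have h2 : c - s • v - (c + t • rot v) = -(s • v + t • rot v) := by abel
  rw [viewAngle, h1, h2]
  simp only [map_sub, map_neg, map_add, map_smul, toC_rot, Complex.real_smul]
  congr 1
  rw [div_neg]
  congr 1
  rw [show (s : ℂ) * toC v - t * (Complex.I * toC v) = (s - t * Complex.I) * toC v by ring,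
    show (s : ℂ) * toC v + t * (Complex.I * toC v) = (s + t * Complex.I) * toC v by ring,
    mul_div_mul_right _ _ hv0]

/-- As the observer reaches the midpoint, the quotient tends to `-1`, from the upper half-plane on
the left of the edge and from the lower one on the right: the angles tend to `π` and `-π`. -/
theorem tendsto_viewAngle_jump (c v : Plane) (hv : v ≠ 0) {s : ℝ} (hs : 0 < s) :
    Filter.Tendsto (fun t : ℝ => viewAngle (c - s • v) (c + s • v) (c + t • rot v) -
      viewAngle (c - s • v) (c + s • v) (c - t • rot v)) (𝓝[>] 0) (𝓝 (2 * Real.pi)) := by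
  have hden : ∀ t : ℝ, (s : ℂ) + t * Complex.I ≠ 0 := by
    intro t h
    have := congrArg Complex.re h
    simp at this
    linarith
  set f : ℝ → ℂ := fun t => -(((s : ℂ) - t * Complex.I) / (s + t * Complex.I)) with hf
  have him : ∀ t : ℝ, 0 < t → 0 < (f t).im := by
    intro t ht
    have : (f t).im = 2 * s * t / (s * s + t * t) := by
      simp [hf, Complex.div_im, Complex.normSq_apply]
      field_simp
      ring
    rw [this]
    positivity
  have h1 : ∀ t : ℝ, 0 < t →
      viewAngle (c - s • v) (c + s • v) (c + t • rot v) -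
      viewAngle (c - s • v) (c + s • v) (c - t • rot v) = 2 * (f t).arg := by
    intro t ht
    have h2 : c - t • rot v = c + (-t) • rot v := by rw [neg_smul, sub_eq_add_neg]
    rw [h2, viewAngle_symm_edge c v hv, viewAngle_symm_edge c v hv]
    -- Reflecting the observer in the edge inverts the quotient and so negates its argument.
    have h3 : -(((s : ℂ) - ((-t : ℝ) : ℂ) * Complex.I) / (s + ((-t : ℝ) : ℂ) * Complex.I))
        = (f t)⁻¹ := by
      have := hden (-t)
      have h4 := hden t
      push_cast at this ⊢
      simp only [hf, inv_neg, inv_div, neg_mul, sub_neg_eq_add]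
      ring
    rw [h3, Complex.arg_inv, if_neg]
    · simp only [hf]; ring
    · intro h
      rw [Complex.arg_eq_pi_iff] at h
      exact (him t ht).ne' h.2
  have hf0 : f 0 = -1 := by
    have : (s : ℂ) ≠ 0 := by exact_mod_cast hs.ne'
    simp [hf, this]
  have h2 : Filter.Tendsto (fun t : ℝ => (f t).arg) (𝓝[>] 0) (𝓝 Real.pi) := by
    have hc := Complex.continuousWithinAt_arg_of_re_neg_of_im_zero (z := -1) (by simp) (by simp)
    have hc' : Filter.Tendsto Complex.arg (𝓝[{z | 0 ≤ z.im}] (-1)) (𝓝 Real.pi) := by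
      have := hc.tendsto
      rwa [Complex.arg_neg_one] at this
    refine hc'.comp ?_
    rw [tendsto_nhdsWithin_iff]
    refine ⟨?_, ?_⟩
    · have hcont : ContinuousAt f 0 := by
        refine ContinuousAt.neg (ContinuousAt.div ?_ ?_ (hden 0)) <;> fun_prop
      have := hcont.tendsto
      rw [hf0] at this
      exact this.mono_left nhdsWithin_le_nhds
    · filter_upwards [self_mem_nhdsWithin] with t ht
      exact (him t ht).le
  have h3 := h2.const_mul 2
  refine h3.congr' ?_
  filter_upwards [self_mem_nhdsWithin] with t ht
  exact (h1 t ht).symm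

/-- The winding number jumps across an edge if the path runs through that edge in one direction
only. -/
theorem eventually_winding_ne {c v : Plane} (hv : v ≠ 0) {l : List (Plane × Plane)}
    (hl : ∀ e ∈ l, (∃ s : ℝ, 0 < s ∧ e = (c - s • v, c + s • v)) ∨ c ∉ segment ℝ e.1 e.2)
    (hex : ∃ e ∈ l, ∃ s : ℝ, 0 < s ∧ e = (c - s • v, c + s • v)) :
    ∀ᶠ t : ℝ in 𝓝[>] 0, winding l (c + t • rot v) ≠ winding l (c - t • rot v) := by
  -- The jump has a limit `K`, to which each passage through `c` contributes `2π` and every other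
  -- edge `0`; as all passages have the same direction, nothing cancels.
  have key : ∃ K : ℝ, Filter.Tendsto
      (fun t : ℝ => winding l (c + t • rot v) - winding l (c - t • rot v)) (𝓝[>] 0) (𝓝 K) ∧
      0 ≤ K ∧ ((∃ e ∈ l, ∃ s : ℝ, 0 < s ∧ e = (c - s • v, c + s • v)) → 0 < K) := by
    clear hex
    induction l with
    | nil => exact ⟨0, by simp [winding_nil], le_rfl, by simp⟩
    | cons e l ih =>
      simp only [List.mem_cons, forall_eq_or_imp] at hl
      obtain ⟨K, hK, hK0, hKp⟩ := ih hl.2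
      by_cases he : ∃ s : ℝ, 0 < s ∧ e = (c - s • v, c + s • v)
      · refine ⟨2 * Real.pi + K, ?_, by positivity, fun _ => by positivity⟩
        obtain ⟨s, hs, rfl⟩ := he
        refine ((tendsto_viewAngle_jump c v hv hs).add hK).congr fun t => ?_
        simp only [winding_cons]; ring
      · have hc := hl.1.resolve_left he
        refine ⟨K, ?_, hK0, ?_⟩
        · have hcont := (continuousAt_viewAngle hc).tendsto
          have ha : Filter.Tendsto (fun t : ℝ => c + t • rot v) (𝓝[>] 0) (𝓝 c) := by
            have : ContinuousAt (fun t : ℝ => c + t • rot v) 0 := by fun_prop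
            have h := this.tendsto
            simp only [zero_smul, add_zero] at h
            exact h.mono_left nhdsWithin_le_nhds
          have hb : Filter.Tendsto (fun t : ℝ => c - t • rot v) (𝓝[>] 0) (𝓝 c) := by
            have : ContinuousAt (fun t : ℝ => c - t • rot v) 0 := by fun_prop
            have h := this.tendsto
            simp only [zero_smul, sub_zero] at h
            exact h.mono_left nhdsWithin_le_nhds
          have h := ((hcont.comp ha).sub (hcont.comp hb)).add hK
          rw [sub_self, zero_add] at h
          refine h.congr fun t => ?_
          simp only [winding_cons, Function.comp]; ring
        · rintro ⟨e', he', hs⟩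
          rcases List.mem_cons.1 he' with rfl | h
          · exact absurd hs he
          · exact hKp ⟨e', h, hs⟩
  obtain ⟨K, hK, -, hKp⟩ := key
  filter_upwards [hK.eventually (lt_mem_nhds (hKp hex))] with t ht h
  rw [h, sub_self] at ht
  exact lt_irrefl _ ht

end TGraph

namespace TGraph

/-! ### The lattice and the covering map -/

theorem latticeVec_apply (z : Fin 2 → ℤ) (k : Fin 2) : latticeVec z k = z k := rfl

theorem latticeVec_add (z w : Fin 2 → ℤ) : latticeVec (z + w) = latticeVec z + latticeVec w := by
  ext k; simp [latticeVec_apply]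

theorem latticeVec_neg (z : Fin 2 → ℤ) : latticeVec (-z) = -latticeVec z := by
  ext k; simp [latticeVec_apply]

theorem latticeVec_zero : latticeVec 0 = 0 := by
  ext k; simp [latticeVec_apply]

theorem latticeVec_injective : Function.Injective latticeVec := by
  intro z w h
  ext k
  have := congrArg (fun v : Plane => v k) h
  simpa [latticeVec_apply] using this

theorem proj_add_latticeVec (x : Plane) (z : Fin 2 → ℤ) : proj (x + latticeVec z) = proj x := by
  ext k
  simp only [proj, PiLp.add_apply, latticeVec_apply, AddCircle.coe_add]
  have : ((z k : ℝ) : UnitAddCircle) = 0 := (AddCircle.coe_eq_zero_iff 1).2 ⟨z k, by simp⟩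
  rw [this, add_zero]

theorem exists_add_latticeVec {x y : Plane} (h : proj x = proj y) :
    ∃ z, y = x + latticeVec z := by
  have : ∀ k, ∃ m : ℤ, y k = x k + m := by
    intro k
    have hk : ((y k : ℝ) : UnitAddCircle) = (x k : ℝ) := (congrFun h k).symm
    rw [← sub_eq_zero, ← AddCircle.coe_sub, AddCircle.coe_eq_zero_iff] at hk
    obtain ⟨m, hm⟩ := hk
    refine ⟨m, ?_⟩
    simp at hm
    linarith
  choose z hz using this
  exact ⟨z, by ext k; simp [latticeVec_apply, hz]⟩

theorem continuous_proj : Continuous proj := by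
  refine continuous_pi fun k => ?_
  exact (AddCircle.continuous_mk' 1).comp (by fun_prop : Continuous fun x : Plane => x k)

theorem isOpenMap_proj : IsOpenMap proj := by
  have h : IsOpenMap (Pi.map fun (_ : Fin 2) (r : ℝ) => (r : UnitAddCircle)) :=
    IsOpenMap.piMap (fun _ => QuotientAddGroup.isOpenMap_coe)
      (Filter.Eventually.of_forall fun _ => QuotientAddGroup.mk_surjective)
  exact h.comp (PiLp.homeomorph 2 fun _ : Fin 2 => ℝ).isOpenMap

theorem finite_latticeVec_norm_le (p : Plane) (R : ℝ) :
    {z : Fin 2 → ℤ | ‖p + latticeVec z‖ ≤ R}.Finite := by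
  obtain ⟨N, hN⟩ := exists_nat_ge (R + ‖p‖)
  refine (Set.finite_Icc (fun _ : Fin 2 => -(N : ℤ)) (fun _ => (N : ℤ))).subset ?_
  intro z hz
  have hz : ‖p + latticeVec z‖ ≤ R := hz
  have h1 : ‖latticeVec z‖ ≤ N := by
    have : latticeVec z = (p + latticeVec z) - p := by abel
    rw [this]
    linarith [norm_sub_le (p + latticeVec z) p]
  have h2 : ∀ k, |z k| ≤ N := by
    intro k
    have h3 := (PiLp.norm_apply_le (latticeVec z) k).trans h1
    rw [latticeVec_apply, Real.norm_eq_abs] at h3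
    exact_mod_cast h3
  exact ⟨fun k => (abs_le.1 (h2 k)).1, fun k => (abs_le.1 (h2 k)).2⟩

theorem cross_add_right (u v w : Plane) : cross u (v + w) = cross u v + cross u w := by
  simp [cross]; ring

theorem cross_smul_right (u v : Plane) (t : ℝ) : cross u (t • v) = t * cross u v := by
  simp [cross]; ring

theorem cross_self (u : Plane) : cross u u = 0 := by
  simp [cross]; ring

theorem cross_rot (u : Plane) : cross u (rot u) = ‖u‖ ^ 2 := by
  rw [EuclideanSpace.norm_sq_eq]
  simp [cross, rot_apply_zero, rot_apply_one]; ring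

theorem cross_rot_pos {u : Plane} (hu : u ≠ 0) : 0 < cross u (rot u) := by
  rw [cross_rot]
  have := norm_pos_iff.2 hu
  positivity

theorem sideSign_not (σ : Bool) : sideSign (!σ) = -sideSign σ := by
  cases σ <;> simp [sideSign]

theorem sideSign_mul_self (σ : Bool) : sideSign σ * sideSign σ = 1 := by
  cases σ <;> simp [sideSign]

namespace TorusTGraph

variable {n : ℕ} {L : TorusTGraph n}

/-! ### Points, breaks and subsegments -/

theorem dir_ne_zero (L : TorusTGraph n) (i : Fin n) : L.b i - L.a i ≠ 0 :=
  sub_ne_zero.2 (L.ne i).symm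

theorem pt_eq (i : Fin n) (r : ℝ) : L.pt i r = L.a i + r • (L.b i - L.a i) := by
  rw [pt, AffineMap.lineMap_apply, vsub_eq_sub, vadd_eq_add, add_comm]

theorem pt_zero (i : Fin n) : L.pt i 0 = L.a i := by simp [pt_eq]

theorem pt_one (i : Fin n) : L.pt i 1 = L.b i := by simp [pt_eq]

theorem pt_injective (i : Fin n) : Function.Injective (L.pt i) := by
  intro r s h
  simp only [pt_eq, add_right_inj] at h
  exact smul_left_injective ℝ (L.dir_ne_zero i) h

theorem continuous_pt (i : Fin n) : Continuous (L.pt i) := AffineMap.lineMap_continuous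

theorem pt_sub_pt (i : Fin n) (r s : ℝ) : L.pt i r - L.pt i s = (r - s) • (L.b i - L.a i) := by
  rw [pt_eq, pt_eq, sub_smul]; abel

theorem mem_openSegment_iff {i : Fin n} {x : Plane} :
    x ∈ openSegment ℝ (L.a i) (L.b i) ↔ ∃ r ∈ Set.Ioo (0 : ℝ) 1, L.pt i r = x := by
  rw [openSegment_eq_image_lineMap]; rfl

theorem pt_mem_openSegment {i : Fin n} {r : ℝ} (hr : r ∈ Set.Ioo (0 : ℝ) 1) :
    L.pt i r ∈ openSegment ℝ (L.a i) (L.b i) := mem_openSegment_iff.2 ⟨r, hr, rfl⟩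

/-- A point of the union of the complete edges has only one position on these edges. -/
theorem position_unique {i j : Fin n} {r s : ℝ} (hr : r ∈ Set.Ioo (0 : ℝ) 1)
    (hs : s ∈ Set.Ioo (0 : ℝ) 1) (h : proj (L.pt i r) = proj (L.pt j s)) : i = j ∧ r = s := by
  have hij : i = j := by
    by_contra hij
    exact Set.disjoint_left.1 (L.disj i j hij) ⟨_, pt_mem_openSegment hr, rfl⟩
      ⟨_, pt_mem_openSegment hs, h.symm⟩
  subst hij
  exact ⟨rfl, pt_injective i (L.inj i (pt_mem_openSegment hr) (pt_mem_openSegment hs) h)⟩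

theorem zero_mem_breaks (i : Fin n) : (0 : ℝ) ∈ L.breaks i :=
  ⟨by simp, i, Or.inl (by rw [pt_zero])⟩

theorem one_mem_breaks (i : Fin n) : (1 : ℝ) ∈ L.breaks i :=
  ⟨by simp, i, Or.inr (by rw [pt_one])⟩

theorem mem_Ioo_of_notMem_breaks {i : Fin n} {r : ℝ} (hr : r ∈ Set.Icc (0 : ℝ) 1)
    (hb : r ∉ L.breaks i) : r ∈ Set.Ioo (0 : ℝ) 1 := by
  refine ⟨lt_of_le_of_ne hr.1 ?_, lt_of_le_of_ne hr.2 ?_⟩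
  · rintro rfl; exact hb (zero_mem_breaks i)
  · rintro rfl; exact hb (one_mem_breaks i)

/-- A point which is no vertex has only one position on the closures of the lifted complete
edges. -/
theorem lifted_position_unique {i j : Fin n} {r s : ℝ} {z w : Fin 2 → ℤ}
    (hr : r ∈ Set.Ioo (0 : ℝ) 1) (hb : r ∉ L.breaks i) (hs : s ∈ Set.Icc (0 : ℝ) 1)
    (h : L.pt i r + latticeVec z = L.pt j s + latticeVec w) : i = j ∧ r = s ∧ z = w := by
  have hp : proj (L.pt i r) = proj (L.pt j s) := by
    rw [← proj_add_latticeVec (L.pt i r) z, h, proj_add_latticeVec]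
  have hsb : s ∉ L.breaks j := by
    rintro ⟨-, hs'⟩
    exact hb ⟨⟨hr.1.le, hr.2.le⟩, hp ▸ hs'⟩
  obtain ⟨rfl, rfl⟩ := position_unique hr (mem_Ioo_of_notMem_breaks hs hsb) hp
  exact ⟨rfl, rfl, latticeVec_injective (add_left_cancel h)⟩

theorem finite_vertexSet (L : TorusTGraph n) : L.vertexSet.Finite := by
  have : L.vertexSet = Set.range (fun i => proj (L.a i)) ∪ Set.range (fun i => proj (L.b i)) := by
    ext v
    simp only [vertexSet, Set.mem_ofPred_eq, Set.mem_union, Set.mem_range]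
    constructor
    · rintro ⟨i, h | h⟩
      · exact Or.inl ⟨i, h.symm⟩
      · exact Or.inr ⟨i, h.symm⟩
    · rintro (⟨i, h⟩ | ⟨i, h⟩)
      · exact ⟨i, Or.inl h.symm⟩
      · exact ⟨i, Or.inr h.symm⟩
  rw [this]
  exact (Set.finite_range _).union (Set.finite_range _)

instance : Finite L.Vertex := L.finite_vertexSet

/-- Interior points of a complete edge embed in the torus, so its interior breaks inject into the
finite set of vertices; `0` and `1` are the only others. -/
theorem finite_breaks (i : Fin n) : (L.breaks i).Finite := by
  have h : (Set.Ioo (0 : ℝ) 1 ∩ (fun r => proj (L.pt i r)) ⁻¹' L.vertexSet).Finite := by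
    refine L.finite_vertexSet.of_injOn (f := fun r => proj (L.pt i r)) (fun r hr => hr.2) ?_
    intro r hr s hs h
    exact (position_unique hr.1 hs.1 h).2
  refine (h.union (Set.toFinite {0, 1})).subset ?_
  rintro r ⟨hr, hv⟩
  by_cases h0 : r = 0
  · exact Or.inr (by simp [h0])
  by_cases h1 : r = 1
  · exact Or.inr (by simp [h1])
  exact Or.inl ⟨⟨lt_of_le_of_ne hr.1 (Ne.symm h0), lt_of_le_of_ne hr.2 h1⟩, hv⟩

/-- Every vertex lies in the interior of a complete edge. -/
theorem exists_position {v : Torus} (hv : v ∈ L.vertexSet) :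
    ∃ i, ∃ r ∈ Set.Ioo (0 : ℝ) 1, proj (L.pt i r) = v := by
  -- The union of the complete edges is closed, so it contains their endpoints.
  have key : ∀ i, ∀ x ∈ closure (openSegment ℝ (L.a i) (L.b i)),
      proj x ∈ ⋃ i, proj '' openSegment ℝ (L.a i) (L.b i) := by
    intro i x hx
    have h1 := image_closure_subset_closure_image continuous_proj (Set.mem_image_of_mem proj hx)
    have h2 := closure_mono (Set.subset_iUnion (fun i => proj '' openSegment ℝ (L.a i) (L.b i)) i)
      h1
    rwa [L.closed.closure_eq] at h2
  have : v ∈ ⋃ i, proj '' openSegment ℝ (L.a i) (L.b i) := by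
    obtain ⟨i, rfl | rfl⟩ := hv
    · exact key i _ (segment_subset_closure_openSegment (left_mem_segment ℝ _ _))
    · exact key i _ (segment_subset_closure_openSegment (right_mem_segment ℝ _ _))
  obtain ⟨i, x, hx, rfl⟩ := Set.mem_iUnion.1 this
  obtain ⟨r, hr, rfl⟩ := mem_openSegment_iff.1 hx
  exact ⟨i, r, hr, rfl⟩

namespace Subsegment

theorem lo_nonneg (S : L.Subsegment) : 0 ≤ S.lo := S.lo_mem.1.1

theorem hi_le_one (S : L.Subsegment) : S.hi ≤ 1 := S.hi_mem.1.2

theorem Ioo_subset (S : L.Subsegment) : Set.Ioo S.lo S.hi ⊆ Set.Ioo (0 : ℝ) 1 :=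
  Set.Ioo_subset_Ioo S.lo_nonneg S.hi_le_one

theorem Icc_subset (S : L.Subsegment) : Set.Icc S.lo S.hi ⊆ Set.Icc (0 : ℝ) 1 :=
  Set.Icc_subset_Icc S.lo_nonneg S.hi_le_one

theorem length_pos (S : L.Subsegment) : 0 < S.length :=
  mul_pos (sub_pos.2 S.lt) (dist_pos.2 (L.ne _))

/-- The parameter of the midpoint of a subsegment. -/
def mid (S : L.Subsegment) : ℝ := (S.lo + S.hi) / 2

theorem mid_mem (S : L.Subsegment) : S.mid ∈ Set.Ioo S.lo S.hi := by
  have := S.lt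
  constructor <;> unfold mid <;> linarith

theorem eq_of_eq {S T : L.Subsegment} (hi : S.idx = T.idx) (h1 : S.lo = T.lo) (h2 : S.hi = T.hi) :
    S = T := by
  cases S; cases T; simp only at hi h1 h2; subst hi; subst h1; subst h2; rfl

/-- The ends of subsegments are breaks and there is no break inside a subsegment, so two overlapping
ones have the same ends. -/
theorem eq_or_disjoint {S T : L.Subsegment} (h : S.idx = T.idx) :
    S = T ∨ S.hi ≤ T.lo ∨ T.hi ≤ S.lo := by
  by_contra! hne
  obtain ⟨hne, h1, h2⟩ := hne
  have key : ∀ {S T : L.Subsegment}, S.idx = T.idx → T.lo < S.hi → S.lo < T.hi →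
      S.lo ≤ T.lo := by
    intro S T h h1 h2
    by_contra! hlt
    exact T.consecutive S.lo ⟨hlt, h2⟩ (h ▸ S.lo_mem)
  have key' : ∀ {S T : L.Subsegment}, S.idx = T.idx → T.lo < S.hi → S.lo < T.hi →
      S.hi ≤ T.hi := by
    intro S T h h1 h2
    by_contra! hlt
    exact S.consecutive T.hi ⟨h2, hlt⟩ (h ▸ T.hi_mem)
  exact hne (eq_of_eq h (le_antisymm (key h h1 h2) (key h.symm h2 h1))
    (le_antisymm (key' h h1 h2) (key' h.symm h2 h1)))

theorem eq_of_mem {S T : L.Subsegment} (h : S.idx = T.idx) {r : ℝ} (hS : r ∈ Set.Ioo S.lo S.hi)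
    (hT : r ∈ Set.Icc T.lo T.hi) : S = T := by
  rcases eq_or_disjoint h with h | h | h
  · exact h
  · exact absurd (hS.2.trans_le (h.trans hT.1)) (lt_irrefl _)
  · exact absurd (hS.1.trans_le (hT.2.trans h)) (lt_irrefl _)

theorem eq_of_lo {S T : L.Subsegment} (h : S.idx = T.idx) (hlo : S.lo = T.lo) : S = T := by
  rcases eq_or_disjoint h with h | h | h
  · exact h
  · linarith [S.lt]
  · linarith [T.lt]

theorem eq_of_hi {S T : L.Subsegment} (h : S.idx = T.idx) (hhi : S.hi = T.hi) : S = T := by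
  rcases eq_or_disjoint h with h | h | h
  · exact h
  · linarith [T.lt]
  · linarith [S.lt]

/-- Distinct lifted subsegments do not meet in interior points. -/
theorem lifted_eq {S T : L.Subsegment} {r s : ℝ} {z w : Fin 2 → ℤ} (hr : r ∈ Set.Ioo S.lo S.hi)
    (hs : s ∈ Set.Icc T.lo T.hi)
    (h : L.pt S.idx r + latticeVec z = L.pt T.idx s + latticeVec w) : S = T ∧ r = s ∧ z = w := by
  obtain ⟨hi, rfl, rfl⟩ := lifted_position_unique (S.Ioo_subset hr) (S.consecutive r hr)
    (T.Icc_subset hs) h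
  exact ⟨eq_of_mem hi hr hs, rfl, rfl⟩

end Subsegment

theorem exists_subsegment_lo {i : Fin n} {r : ℝ} (hr : r ∈ L.breaks i) (h1 : r < 1) :
    ∃ S : L.Subsegment, S.idx = i ∧ S.lo = r := by
  have hne : (L.breaks i ∩ Set.Ioi r).Nonempty := ⟨1, one_mem_breaks i, h1⟩
  obtain ⟨s, hs, hmin⟩ := Set.exists_min_image _ id ((finite_breaks i).inter_of_left _) hne
  exact ⟨⟨i, r, s, hs.2, hr, hs.1, fun t ht htb => absurd (hmin t ⟨htb, ht.1⟩) (not_le.2 ht.2)⟩,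
    rfl, rfl⟩

theorem exists_subsegment_hi {i : Fin n} {r : ℝ} (hr : r ∈ L.breaks i) (h0 : 0 < r) :
    ∃ S : L.Subsegment, S.idx = i ∧ S.hi = r := by
  have hne : (L.breaks i ∩ Set.Iio r).Nonempty := ⟨0, zero_mem_breaks i, h0⟩
  obtain ⟨s, hs, hmax⟩ := Set.exists_max_image _ id ((finite_breaks i).inter_of_left _) hne
  exact ⟨⟨i, s, r, hs.2, hs.1, hr, fun t ht htb => absurd (hmax t ⟨htb, ht.2⟩) (not_le.2 ht.1)⟩,
    rfl, rfl⟩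

instance : Finite L.Subsegment := by
  have : ∀ i, Finite (L.breaks i) := fun i => finite_breaks i
  refine Finite.of_injective
    (fun S : L.Subsegment => (⟨S.idx, S.lo, S.lo_mem⟩ : Σ i, L.breaks i)) ?_
  intro S T h
  simp only [Sigma.mk.injEq] at h
  obtain ⟨h1, h2⟩ := h
  refine Subsegment.eq_of_lo h1 ?_
  cases S; cases T
  simp only at h1
  subst h1
  simpa using h2

instance : Finite L.TEdge := by
  refine Finite.of_injective (fun d : L.TEdge => (d.seg, d.fwd)) ?_
  intro d d' h
  cases d; cases d'
  simp only [Prod.mk.injEq] at h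
  obtain ⟨rfl, rfl⟩ := h
  rfl

/-! ### The lifted graph -/

/-- The union of all lifts of the complete edges to the plane. -/
def cover (L : TorusTGraph n) : Set Plane := proj ⁻¹' L.support

theorem mem_cover_iff {x : Plane} : x ∈ L.cover ↔
    ∃ i, ∃ r ∈ Set.Ioo (0 : ℝ) 1, ∃ z, x = L.pt i r + latticeVec z := by
  constructor
  · intro h
    obtain ⟨i, y, hy, hyx⟩ := Set.mem_iUnion.1 h
    obtain ⟨r, hr, rfl⟩ := mem_openSegment_iff.1 hy
    exact ⟨i, r, hr, exists_add_latticeVec hyx⟩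
  · rintro ⟨i, r, hr, z, rfl⟩
    exact Set.mem_iUnion.2 ⟨i, _, pt_mem_openSegment hr, (proj_add_latticeVec _ _).symm⟩

theorem isOpen_compl_cover (L : TorusTGraph n) : IsOpen L.coverᶜ :=
  (L.closed.preimage continuous_proj).isOpen_compl

theorem mem_cover_of_mem_Icc {i : Fin n} {r : ℝ} (hr : r ∈ Set.Icc (0 : ℝ) 1) (z : Fin 2 → ℤ) :
    L.pt i r + latticeVec z ∈ L.cover := by
  by_cases hb : r ∈ L.breaks i
  · obtain ⟨j, s, hs, h⟩ := exists_position hb.2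
    obtain ⟨w, hw⟩ := exists_add_latticeVec h
    exact mem_cover_iff.2 ⟨j, s, hs, w + z, by rw [hw, latticeVec_add]; abel⟩
  · exact mem_cover_iff.2 ⟨i, r, mem_Ioo_of_notMem_breaks hr hb, z, rfl⟩

/-- Near a point of a complete edge which is no vertex, the lifted graph is contained in the line
through that edge. -/
theorem eventually_cross_eq_zero {i : Fin n} {r : ℝ} (hr : r ∈ Set.Ioo (0 : ℝ) 1)
    (hb : r ∉ L.breaks i) (z : Fin 2 → ℤ) :
    ∀ᶠ y in 𝓝 (L.pt i r + latticeVec z), y ∈ L.cover →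
      cross (L.b i - L.a i) (y - (L.pt i r + latticeVec z)) = 0 := by
  set x := L.pt i r + latticeVec z with hx
  -- `T` collects the other lifted complete edges whose closures come within distance `1` of `x`.
  -- There are finitely many, and the union of their closures is closed and misses `x`, which is no
  -- vertex.
  set T : Set (Fin n × (Fin 2 → ℤ)) := {p | p ≠ (i, z) ∧
    ∃ s ∈ Set.Icc (0 : ℝ) 1, ‖L.pt p.1 s + latticeVec p.2 - x‖ ≤ 1} with hT
  have hfin : T.Finite := by
    have : T ⊆ ⋃ j : Fin n, (Prod.mk j) '' {w : Fin 2 → ℤ |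
        ‖(L.a j - x) + latticeVec w‖ ≤ 1 + ‖L.b j - L.a j‖} := by
      rintro ⟨j, w⟩ ⟨-, s, hs, hle⟩
      refine Set.mem_iUnion.2 ⟨j, w, ?_, rfl⟩
      have h1 : (L.a j - x) + latticeVec w =
          (L.pt j s + latticeVec w - x) - s • (L.b j - L.a j) := by rw [pt_eq]; abel
      have h2 : ‖s • (L.b j - L.a j)‖ ≤ ‖L.b j - L.a j‖ := by
        rw [norm_smul, Real.norm_of_nonneg hs.1]
        exact mul_le_of_le_one_left (norm_nonneg _) hs.2
      simp only [Set.mem_ofPred_eq]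
      rw [h1]
      exact (norm_sub_le _ _).trans (add_le_add hle h2)
    exact (Set.finite_iUnion fun j => (finite_latticeVec_norm_le _ _).image _).subset this
  set K : Set Plane := ⋃ p ∈ T, (fun s => L.pt p.1 s + latticeVec p.2) '' Set.Icc (0 : ℝ) 1
    with hK
  have hKc : IsClosed K := by
    refine hfin.isClosed_biUnion fun p _ => ?_
    exact (isCompact_Icc.image ((continuous_pt p.1).add continuous_const)).isClosed
  have hxK : x ∉ K := by
    intro h
    obtain ⟨p, hp, s, hs, hps⟩ := Set.mem_iUnion₂.1 h
    obtain ⟨h1, -, h2⟩ := lifted_position_unique hr hb hs (hx.symm.trans hps.symm)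
    exact hp.1 (Prod.ext h1.symm h2.symm)
  filter_upwards [hKc.isOpen_compl.mem_nhds hxK, Metric.ball_mem_nhds x one_pos] with y hy hy1 hyc
  obtain ⟨j, s, hs, w, rfl⟩ := mem_cover_iff.1 hyc
  by_cases hjw : (j, w) = (i, z)
  · obtain ⟨rfl, rfl⟩ := Prod.mk.inj hjw
    rw [hx, add_sub_add_right_eq_sub, pt_sub_pt, cross_smul_right, cross_self, mul_zero]
  · exfalso
    apply hy
    refine Set.mem_iUnion₂.2 ⟨(j, w), ⟨hjw, s, ⟨hs.1.le, hs.2.le⟩, ?_⟩, s, ⟨hs.1.le, hs.2.le⟩, rfl⟩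
    rw [← dist_eq_norm]
    exact (Metric.mem_ball.1 hy1).le

end TorusTGraph
end TGraph

namespace TGraph
namespace TorusTGraph

variable {n : ℕ} {L : TorusTGraph n}

/-! ### Faces and their lifts -/

theorem Face.eq_component {φ : L.Face} {p : Torus} (h : p ∈ φ.1) :
    φ.1 = connectedComponentIn L.supportᶜ p := by
  obtain ⟨q, -, hq⟩ := φ.2
  rw [hq] at h ⊢
  exact connectedComponentIn_eq h

theorem Face.eq_of_mem {φ ψ : L.Face} {p : Torus} (h1 : p ∈ φ.1) (h2 : p ∈ ψ.1) : φ = ψ :=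
  Subtype.ext ((Face.eq_component h1).trans (Face.eq_component h2).symm)

theorem Face.isPreconnected (φ : L.Face) : IsPreconnected φ.1 := by
  obtain ⟨φ, q, -, rfl⟩ := φ
  exact isPreconnected_connectedComponentIn

theorem Face.subset (φ : L.Face) : φ.1 ⊆ L.supportᶜ := by
  obtain ⟨φ, q, -, rfl⟩ := φ
  exact connectedComponentIn_subset _ _

/-- The lifted face containing a given point. -/
def liftedFaceAt (x : Plane) (hx : x ∈ L.coverᶜ) : L.LiftedFace :=
  ⟨connectedComponentIn L.coverᶜ x, x, hx, rfl⟩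

theorem mem_liftedFaceAt (x : Plane) (hx : x ∈ L.coverᶜ) : x ∈ (liftedFaceAt x hx).1 :=
  mem_connectedComponentIn hx

namespace LiftedFace

theorem isOpen (Q : L.LiftedFace) : IsOpen Q.1 := by
  obtain ⟨Q, q, -, rfl⟩ := Q
  exact L.isOpen_compl_cover.connectedComponentIn

theorem isPreconnected (Q : L.LiftedFace) : IsPreconnected Q.1 := by
  obtain ⟨Q, q, -, rfl⟩ := Q
  exact isPreconnected_connectedComponentIn

theorem subset (Q : L.LiftedFace) : Q.1 ⊆ L.coverᶜ := by
  obtain ⟨Q, q, -, rfl⟩ := Q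
  exact connectedComponentIn_subset _ _

theorem nonempty (Q : L.LiftedFace) : Q.1.Nonempty := by
  obtain ⟨Q, q, hq, rfl⟩ := Q
  exact ⟨q, mem_connectedComponentIn hq⟩

theorem eq_component {Q : L.LiftedFace} {x : Plane} (h : x ∈ Q.1) :
    Q.1 = connectedComponentIn L.coverᶜ x := by
  obtain ⟨q, -, hq⟩ := Q.2
  rw [hq] at h ⊢
  exact connectedComponentIn_eq h

theorem eq_of_mem {P Q : L.LiftedFace} {x : Plane} (h1 : x ∈ P.1) (h2 : x ∈ Q.1) : P = Q :=
  Subtype.ext ((eq_component h1).trans (eq_component h2).symm)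

theorem subset_of_mem {Q : L.LiftedFace} {A : Set Plane} (hA : IsPreconnected A)
    (hAc : A ⊆ L.coverᶜ) {x : Plane} (h1 : x ∈ A) (h2 : x ∈ Q.1) : A ⊆ Q.1 := by
  rw [eq_component h2]
  exact hA.subset_connectedComponentIn h1 hAc

/-- A lifted face lies over any face over which it has a point. -/
theorem subset_preimage {Q : L.LiftedFace} {φ : L.Face} {x : Plane} (hx : x ∈ Q.1)
    (hφ : proj x ∈ φ.1) : Q.1 ⊆ proj ⁻¹' φ.1 := by
  intro y hy
  have h1 : proj '' Q.1 ⊆ connectedComponentIn L.supportᶜ (proj x) := by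
    refine (Q.isPreconnected.image proj continuous_proj.continuousOn).subset_connectedComponentIn
      ⟨x, hx, rfl⟩ ?_
    rintro _ ⟨w, hw, rfl⟩
    exact Q.subset hw
  have h2 := h1 ⟨y, hy, rfl⟩
  rwa [← Face.eq_component hφ] at h2

theorem exists_face (Q : L.LiftedFace) : ∃ φ : L.Face, Q.1 ⊆ proj ⁻¹' φ.1 := by
  obtain ⟨x, hx⟩ := Q.nonempty
  have hpx : proj x ∈ L.supportᶜ := Q.subset hx
  exact ⟨⟨connectedComponentIn L.supportᶜ (proj x), _, hpx, rfl⟩,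
    subset_preimage hx (mem_connectedComponentIn hpx)⟩

/-- The translate of a lifted face by a lattice vector. -/
def translate (Q : L.LiftedFace) (z : Fin 2 → ℤ) : L.LiftedFace :=
  ⟨(fun x => x - latticeVec z) ⁻¹' Q.1, by
    obtain ⟨Q, x, hx, rfl⟩ := Q
    have hinv : ∀ y, y ∈ L.coverᶜ ↔ y - latticeVec z ∈ L.coverᶜ := by
      intro y
      simp only [cover, Set.mem_compl_iff, Set.mem_preimage]
      rw [sub_eq_add_neg, ← latticeVec_neg, proj_add_latticeVec]
    have hx2 : x + latticeVec z ∈ L.coverᶜ := by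
      rw [hinv, add_sub_cancel_right]; exact hx
    refine ⟨x + latticeVec z, hx2, ?_⟩
    have himg : ∀ A : Set Plane, (fun x => x - latticeVec z) ⁻¹' A =
        (Homeomorph.addRight (latticeVec z)) '' A := by
      intro A
      rw [Homeomorph.image_eq_preimage_symm]
      ext y
      rw [Set.mem_preimage, sub_eq_add_neg]
      rfl
    have h := (Homeomorph.addRight (latticeVec z)).image_connectedComponentIn
      (s := L.coverᶜ) (x := x) hx
    have h2 : (Homeomorph.addRight (latticeVec z)) '' L.coverᶜ = L.coverᶜ := by
      rw [← himg]; ext y; exact (hinv y).symm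
    rw [h2] at h
    change _ ⁻¹' (connectedComponentIn L.coverᶜ x) = _
    rw [himg, h]; rfl⟩

theorem mem_translate {Q : L.LiftedFace} {z : Fin 2 → ℤ} {x : Plane} :
    x ∈ (Q.translate z).1 ↔ x - latticeVec z ∈ Q.1 := Iff.rfl

/-- The lifts of a face are translates of each other. -/
theorem exists_translate_mem {Q : L.LiftedFace} {φ : L.Face} (hQ : Q.1 ⊆ proj ⁻¹' φ.1)
    {x : Plane} (hx : proj x ∈ φ.1) : ∃ z, x + latticeVec z ∈ Q.1 := by
  -- The connected face `φ` is covered by two disjoint open sets: the image of `Q`, and the union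
  -- `V` of the images of the lifted faces whose image misses it. So it lies in the first.
  set V : Set Torus := ⋃ P ∈ {P : L.LiftedFace | Disjoint (proj '' P.1) (proj '' Q.1)},
    proj '' P.1 with hV
  have hVo : IsOpen V := isOpen_biUnion fun P _ => isOpenMap_proj _ P.isOpen
  have hd : Disjoint (proj '' Q.1) V := by
    rw [hV, Set.disjoint_iUnion₂_right]
    exact fun P hP => Disjoint.symm hP
  have hcov : φ.1 ⊆ proj '' Q.1 ∪ V := by
    intro p hp
    obtain ⟨y, rfl⟩ : ∃ y, proj y = p := by
      choose r hr using fun k => QuotientAddGroup.mk_surjective (s := AddSubgroup.zmultiples (1 : ℝ)) (p k)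
      exact ⟨WithLp.toLp 2 r, by ext k; exact hr k⟩
    have hy : y ∈ L.coverᶜ := φ.subset hp
    by_cases h : Disjoint (proj '' (liftedFaceAt y hy).1) (proj '' Q.1)
    · exact Or.inr (Set.mem_iUnion₂.2 ⟨_, h, y, mem_liftedFaceAt y hy, rfl⟩)
    · left
      rw [Set.not_disjoint_iff] at h
      obtain ⟨_, ⟨a, ha, rfl⟩, ⟨b, hb, hab⟩⟩ := h
      obtain ⟨z, rfl⟩ := exists_add_latticeVec hab.symm
      have h2 : (liftedFaceAt y hy).translate z = Q :=
        eq_of_mem (x := a + latticeVec z) (mem_translate.2 (by rwa [add_sub_cancel_right])) hb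
      refine ⟨y + latticeVec z, ?_, proj_add_latticeVec _ _⟩
      rw [← h2, mem_translate, add_sub_cancel_right]
      exact mem_liftedFaceAt y hy
  have hne : (φ.1 ∩ proj '' Q.1).Nonempty := by
    obtain ⟨y, hy⟩ := Q.nonempty
    exact ⟨proj y, hQ hy, y, hy, rfl⟩
  obtain ⟨y, hy, hyx⟩ := IsPreconnected.subset_left_of_subset_union (isOpenMap_proj _ Q.isOpen) hVo
    hd hcov hne φ.isPreconnected hx
  obtain ⟨z, rfl⟩ := exists_add_latticeVec hyx.symm
  exact ⟨z, hy⟩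

end LiftedFace

/-! ### The faces beside a complete edge -/

/-- A vector pointing to side `σ` of the `i`-th complete edge. -/
def sideVec (L : TorusTGraph n) (i : Fin n) (σ : Bool) : Plane :=
  sideSign σ • rot (L.b i - L.a i)

theorem sideVec_not (i : Fin n) (σ : Bool) : L.sideVec i (!σ) = -L.sideVec i σ := by
  rw [sideVec, sideSign_not, neg_smul, sideVec]

theorem cross_sideVec_pos (L : TorusTGraph n) (i : Fin n) (σ : Bool) :
    0 < sideSign σ * cross (L.b i - L.a i) (L.sideVec i σ) := by
  rw [sideVec, cross_smul_right, ← mul_assoc, sideSign_mul_self, one_mul]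
  exact cross_rot_pos (L.dir_ne_zero i)

theorem Beside.mono {A B : Set Plane} (h : A ⊆ B) {i : Fin n} {σ : Bool} {x : Plane}
    (hA : L.Beside A i σ x) : L.Beside B i σ x := by
  filter_upwards [hA] with y hy h0 using h (hy h0)

theorem Beside.eventually_mem {A : Set Plane} {i : Fin n} {σ : Bool} {x : Plane}
    (hA : L.Beside A i σ x) : ∀ᶠ t : ℝ in 𝓝[>] 0, x + t • L.sideVec i σ ∈ A := by
  have hc : Filter.Tendsto (fun t : ℝ => x + t • L.sideVec i σ) (𝓝[>] 0) (𝓝 x) := by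
    have : ContinuousAt (fun t : ℝ => x + t • L.sideVec i σ) 0 := by fun_prop
    have h := this.tendsto
    simp only [zero_smul, add_zero] at h
    exact h.mono_left nhdsWithin_le_nhds
  filter_upwards [hc.eventually hA, self_mem_nhdsWithin] with t ht ht0
  apply ht
  rw [add_sub_cancel_left, cross_smul_right]
  have := cross_sideVec_pos L i σ
  have ht0 : 0 < t := ht0
  nlinarith

theorem Beside.inter_nonempty {A B : Set Plane} {i : Fin n} {σ : Bool} {x : Plane}
    (hA : L.Beside A i σ x) (hB : L.Beside B i σ x) : (A ∩ B).Nonempty := by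
  obtain ⟨t, h1, h2⟩ := (hA.eventually_mem.and hB.eventually_mem).exists
  exact ⟨_, h1, h2⟩

theorem Beside.eq {P Q : L.LiftedFace} {i : Fin n} {σ : Bool} {x : Plane}
    (hP : L.Beside P.1 i σ x) (hQ : L.Beside Q.1 i σ x) : P = Q := by
  obtain ⟨y, h1, h2⟩ := hP.inter_nonempty hQ
  exact LiftedFace.eq_of_mem h1 h2

theorem Beside.face_eq {φ ψ : L.Face} {i : Fin n} {σ : Bool} {x : Plane}
    (hP : L.Beside (proj ⁻¹' φ.1) i σ x) (hQ : L.Beside (proj ⁻¹' ψ.1) i σ x) : φ = ψ := by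
  obtain ⟨y, h1, h2⟩ := hP.inter_nonempty hQ
  exact Face.eq_of_mem h1 h2

theorem Beside.subset_preimage {Q : L.LiftedFace} {φ : L.Face} {i : Fin n} {σ : Bool} {x : Plane}
    (hQ : L.Beside Q.1 i σ x) (hφ : L.Beside (proj ⁻¹' φ.1) i σ x) : Q.1 ⊆ proj ⁻¹' φ.1 := by
  obtain ⟨y, h1, h2⟩ := hQ.inter_nonempty hφ
  exact LiftedFace.subset_preimage h1 h2

theorem Beside.translate {Q : L.LiftedFace} {i : Fin n} {σ : Bool} {x : Plane}
    (hQ : L.Beside Q.1 i σ x) (z : Fin 2 → ℤ) :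
    L.Beside (Q.translate z).1 i σ (x + latticeVec z) := by
  have hc : Filter.Tendsto (fun y : Plane => y - latticeVec z) (𝓝 (x + latticeVec z)) (𝓝 x) := by
    have : ContinuousAt (fun y : Plane => y - latticeVec z) (x + latticeVec z) := by fun_prop
    have h := this.tendsto
    rwa [add_sub_cancel_right] at h
  filter_upwards [hc.eventually hQ] with y hy h0
  rw [LiftedFace.mem_translate]
  apply hy
  convert h0 using 3
  abel

/-- Bordering a set from one side is an open condition along a complete edge. -/
theorem Beside.eventually {A : Set Plane} {i : Fin n} {σ : Bool} {r : ℝ} {w : Plane}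
    (hA : L.Beside A i σ (L.pt i r + w)) : ∀ᶠ s in 𝓝 r, L.Beside A i σ (L.pt i s + w) := by
  have h := eventually_eventually_nhds.2 hA
  have hc : ContinuousAt (fun s => L.pt i s + w) r :=
    ((continuous_pt i).add continuous_const).continuousAt
  filter_upwards [hc.eventually h] with s hs
  filter_upwards [hs] with y hy h0
  apply hy
  -- Moving the base point along the complete edge does not change on which side `y` lies.
  have : y - (L.pt i r + w) = (y - (L.pt i s + w)) + (s - r) • (L.b i - L.a i) := by
    rw [← pt_sub_pt]; abel
  rw [this, cross_add_right, cross_smul_right, cross_self, mul_zero, add_zero]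
  exact h0

theorem convex_side (i : Fin n) (σ : Bool) (x : Plane) :
    Convex ℝ {y | 0 < sideSign σ * cross (L.b i - L.a i) (y - x)} := by
  have h : IsLinearMap ℝ fun y => sideSign σ * cross (L.b i - L.a i) y :=
    ⟨fun y w => by rw [cross_add_right, mul_add], fun t y => by
      rw [cross_smul_right, smul_eq_mul]; ring⟩
  have hset : {y | 0 < sideSign σ * cross (L.b i - L.a i) (y - x)} =
      {y | sideSign σ * cross (L.b i - L.a i) x < sideSign σ * cross (L.b i - L.a i) y} := by
    ext y
    have : sideSign σ * cross (L.b i - L.a i) y = sideSign σ * cross (L.b i - L.a i) (y - x) +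
        sideSign σ * cross (L.b i - L.a i) x := by
      rw [← mul_add, ← cross_add_right, sub_add_cancel]
    simp only [Set.mem_ofPred_eq, this]
    constructor <;> intro h <;> linarith
  rw [hset]
  exact convex_halfSpace_gt h _

/-- Near a point which is no vertex the graph lies in one line, so a small half-disc on side `σ`
avoids it; being convex, it lies in one lifted face. -/
theorem exists_beside {i : Fin n} {r : ℝ} (hr : r ∈ Set.Ioo (0 : ℝ) 1) (hb : r ∉ L.breaks i)
    (σ : Bool) (z : Fin 2 → ℤ) :
    ∃ Q : L.LiftedFace, L.Beside Q.1 i σ (L.pt i r + latticeVec z) := by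
  set x := L.pt i r + latticeVec z with hx
  obtain ⟨ε, hε, hball⟩ := Metric.eventually_nhds_iff_ball.1 (eventually_cross_eq_zero hr hb z)
  set A := Metric.ball x ε ∩ {y | 0 < sideSign σ * cross (L.b i - L.a i) (y - x)} with hA
  have hconv : Convex ℝ A := (convex_ball x ε).inter (convex_side i σ x)
  have hAc : A ⊆ L.coverᶜ := by
    intro y hy hyc
    have h0 := hball y hy.1 hyc
    have h1 : 0 < sideSign σ * cross (L.b i - L.a i) (y - x) := hy.2
    rw [h0, mul_zero] at h1
    exact lt_irrefl _ h1
  have hbA : L.Beside A i σ x := by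
    filter_upwards [Metric.ball_mem_nhds x hε] with y hy h0 using ⟨hy, h0⟩
  obtain ⟨y, hy, -⟩ := hbA.inter_nonempty hbA
  exact ⟨liftedFaceAt y (hAc hy), hbA.mono
    (LiftedFace.subset_of_mem hconv.isPreconnected hAc hy (mem_liftedFaceAt y (hAc hy)))⟩

/-- A lifted subsegment borders one lifted face on each side. -/
theorem exists_beside_subsegment (S : L.Subsegment) (σ : Bool) (z : Fin 2 → ℤ) :
    ∃ Q : L.LiftedFace, ∀ r ∈ Set.Ioo S.lo S.hi,
      L.Beside Q.1 S.idx σ (L.pt S.idx r + latticeVec z) := by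
  obtain ⟨Q, hQ⟩ := exists_beside (S.Ioo_subset S.mid_mem) (S.consecutive _ S.mid_mem) σ z
  refine ⟨Q, ?_⟩
  -- The parameters bordering `Q` and those bordering another lifted face form two disjoint open
  -- sets covering an interval.
  refine IsPreconnected.subset_left_of_subset_union
    (u := {r | L.Beside Q.1 S.idx σ (L.pt S.idx r + latticeVec z)})
    (v := {r | ∃ P : L.LiftedFace, P ≠ Q ∧ L.Beside P.1 S.idx σ (L.pt S.idx r + latticeVec z)})
    ?_ ?_ ?_ ?_ ⟨S.mid, S.mid_mem, hQ⟩ isPreconnected_Ioo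
  · exact isOpen_iff_mem_nhds.2 fun r hr => Beside.eventually hr
  · refine isOpen_iff_mem_nhds.2 ?_
    rintro r ⟨P, hP, h⟩
    filter_upwards [h.eventually] with s hs using ⟨P, hP, hs⟩
  · rw [Set.disjoint_left]
    rintro r h1 ⟨P, hP, h2⟩
    exact hP (Beside.eq h2 h1)
  · intro r hr
    obtain ⟨P, hP⟩ := exists_beside (S.Ioo_subset hr) (S.consecutive r hr) σ z
    by_cases h : P = Q
    · exact Or.inl (h ▸ hP)
    · exact Or.inr ⟨P, h, hP⟩

/-! ### Directed edges of the dual graph -/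

theorem exists_face_beside (S : L.Subsegment) (σ : Bool) :
    ∃ φ : L.Face, Set.Ioo S.lo S.hi ⊆ L.sideSet φ S.idx σ := by
  obtain ⟨Q, hQ⟩ := exists_beside_subsegment S σ 0
  obtain ⟨φ, hφ⟩ := Q.exists_face
  refine ⟨φ, fun r hr => ⟨S.Ioo_subset hr, ?_⟩⟩
  have := (hQ r hr).mono hφ
  rwa [latticeVec_zero, add_zero] at this

theorem face_eq_of_mem_sideSet {φ ψ : L.Face} {i : Fin n} {σ : Bool} {r : ℝ}
    (h1 : r ∈ L.sideSet φ i σ) (h2 : r ∈ L.sideSet ψ i σ) : φ = ψ :=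
  Beside.face_eq h1.2 h2.2

theorem exists_dart (S : L.Subsegment) (σ : Bool) : ∃ d : L.DualDart, d.seg = S ∧ d.side = σ := by
  obtain ⟨φ, hφ⟩ := exists_face_beside S σ
  obtain ⟨ψ, hψ⟩ := exists_face_beside S (!σ)
  exact ⟨⟨S, σ, φ, ψ, hφ, hψ⟩, rfl, rfl⟩

theorem DualDart.src_eq {d : L.DualDart} {φ : L.Face} {r : ℝ}
    (hr : r ∈ Set.Ioo d.seg.lo d.seg.hi) (h : r ∈ L.sideSet φ d.seg.idx d.side) : d.src = φ :=
  face_eq_of_mem_sideSet (d.src_spec hr) h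

/-- Only one face borders a given side of a subsegment, so source and target carry no further
information. -/
theorem DualDart.eq_of_seg_side {d d' : L.DualDart} (h1 : d.seg = d'.seg)
    (h2 : d.side = d'.side) : d = d' := by
  obtain ⟨S, σ, φ, ψ, hφ, hψ⟩ := d
  obtain ⟨S', σ', φ', ψ', hφ', hψ'⟩ := d'
  simp only at h1 h2
  subst h1 h2
  obtain rfl := face_eq_of_mem_sideSet (hφ S.mid_mem) (hφ' S.mid_mem)
  obtain rfl := face_eq_of_mem_sideSet (hψ S.mid_mem) (hψ' S.mid_mem)
  rfl

instance : Finite L.DualDart := by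
  refine Finite.of_injective (fun d : L.DualDart => (d.seg, d.side)) ?_
  intro d d' h
  simp only [Prod.mk.injEq] at h
  exact DualDart.eq_of_seg_side h.1 h.2

/-- A directed dual edge can be lifted to start at any lift of its source. -/
theorem DualDart.exists_lift (d : L.DualDart) {Q : L.LiftedFace} (hQ : Q.1 ⊆ proj ⁻¹' d.src.1) :
    ∃ P, d.Lift Q P := by
  obtain ⟨Q₀, hQ₀⟩ := exists_beside_subsegment d.seg d.side 0
  have h1 := hQ₀ _ d.seg.mid_mem
  have h2 := (d.src_spec d.seg.mid_mem).2
  rw [latticeVec_zero, add_zero] at h1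
  have h3 := Beside.subset_preimage h1 h2
  obtain ⟨x, hx⟩ := Q₀.nonempty
  obtain ⟨z, hz⟩ := LiftedFace.exists_translate_mem hQ (h3 hx)
  have hQz : Q = Q₀.translate z :=
    LiftedFace.eq_of_mem hz (LiftedFace.mem_translate.2 (by rwa [add_sub_cancel_right]))
  obtain ⟨P, hP⟩ := exists_beside_subsegment d.seg (!d.side) z
  refine ⟨P, z, fun r hr => ⟨?_, hP r hr⟩⟩
  rw [hQz]
  have := hQ₀ r hr
  rw [latticeVec_zero, add_zero] at this
  exact this.translate z

/-- Crossing a subsegment back and forth is a null-homotopic cycle of the dual graph. -/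
theorem DualDart.exists_two_cycle {d d' : L.DualDart} (h : d.seg = d'.seg)
    (hs : d.side = !d'.side) : ∃ P Q, d.Lift P Q ∧ d'.Lift Q P := by
  obtain ⟨P, hP⟩ := exists_beside_subsegment d.seg d.side 0
  obtain ⟨Q, hQ⟩ := exists_beside_subsegment d.seg (!d.side) 0
  refine ⟨P, Q, ⟨0, fun r hr => ⟨hP r hr, hQ r hr⟩⟩, ⟨0, ?_⟩⟩
  rw [← h]
  intro r hr
  have h1 := hP r hr
  have h2 := hQ r hr
  rw [hs] at h1 h2
  rw [Bool.not_not] at h2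
  exact ⟨h2, h1⟩

end TorusTGraph
end TGraph

namespace TGraph

/-! ### Rotations, and cycles in finite relations -/

theorem rot_smul (t : ℝ) (v : Plane) : rot (t • v) = t • rot v := by
  ext k
  fin_cases k
  · simp [rot_apply_zero]
  · simp [rot_apply_one]

theorem rot_rot (v : Plane) : rot (rot v) = -v := by
  ext k
  fin_cases k
  · simp [rot_apply_zero, rot_apply_one]
  · simp [rot_apply_zero, rot_apply_one]

/-- A relation with successors in a finite set has a cycle in that set. -/
theorem exists_cycle_of_finite {α : Type*} {r : α → α → Prop} {s : Set α} (hs : s.Finite)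
    (hne : s.Nonempty) (h : ∀ a ∈ s, ∃ b ∈ s, r a b) :
    ∃ a, Relation.TransGen (fun a b => a ∈ s ∧ b ∈ s ∧ r a b) a a := by
  by_contra! hc
  have : Finite s := hs
  -- Without a cycle, "reachable from" is a strict order on a finite set; an element from which
  -- nothing can be reached contradicts `h`.
  let r' : s → s → Prop := fun a b =>
    Relation.TransGen (fun a b => a ∈ s ∧ b ∈ s ∧ r a b) b.1 a.1
  have : IsTrans s r' := ⟨fun a b c hab hbc => Relation.TransGen.trans hbc hab⟩
  have : Std.Irrefl r' := ⟨fun a => hc a.1⟩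
  have hwf := Finite.wellFounded_of_trans_of_irrefl r'
  obtain ⟨a, ha⟩ := hne
  obtain ⟨m, -, hm⟩ := hwf.has_min Set.univ ⟨⟨a, ha⟩, trivial⟩
  obtain ⟨b, hb, hr⟩ := h m.1 m.2
  exact hm ⟨b, hb⟩ trivial (Relation.TransGen.single ⟨m.2, hb, hr⟩)

namespace TorusTGraph

variable {n : ℕ} {L : TorusTGraph n}

/-! ### Complementary functional graphs have no contractible cycles -/

/-- A set of directed edges of `𝒢_T` and a set of directed dual edges such that an edge goes out of
every vertex and of every face, and no subsegment is used or crossed twice. -/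
structure Complementary (F : Set L.TEdge) (F' : Set L.DualDart) : Prop where
  exists_edge : ∀ v : L.Vertex, ∃ d ∈ F, d.src = v
  seg_ne : ∀ d ∈ F, ∀ d' ∈ F', d.seg ≠ d'.seg
  edge_eq : ∀ d ∈ F, ∀ d' ∈ F, d.seg = d'.seg → d = d'
  dart_eq : ∀ d ∈ F', ∀ d' ∈ F', d.seg = d'.seg → d = d'
  exists_dart : ∀ φ : L.Face, ∃ d ∈ F', d.src = φ

/-- The lift of the subsegment `S` by `z`, as a set. -/
def Subsegment.lift (S : L.Subsegment) (z : Fin 2 → ℤ) (A : Set ℝ) : Set Plane :=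
  (fun r => L.pt S.idx r + latticeVec z) '' A

theorem Subsegment.isPreconnected_lift (S : L.Subsegment) (z : Fin 2 → ℤ) {A : Set ℝ}
    (hA : IsPreconnected A) : IsPreconnected (S.lift z A) :=
  hA.image _ ((continuous_pt _).add continuous_const).continuousOn

theorem exists_mem_uIcc_of_mem_segment {i : Fin n} {r s : ℝ} {w x : Plane}
    (hx : x ∈ segment ℝ (L.pt i r + w) (L.pt i s + w)) :
    ∃ t ∈ Set.uIcc r s, x = L.pt i t + w := by
  obtain ⟨a, b, ha, hb, hab, rfl⟩ := hx
  refine ⟨a * r + b * s, ?_, ?_⟩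
  · rw [← segment_eq_uIcc]
    exact ⟨a, b, ha, hb, hab, by simp⟩
  · obtain rfl : a = 1 - b := by linarith
    simp only [pt_eq]
    ext k
    simp
    ring

namespace TEdge

theorem exists_of_mem_segment {d : L.TEdge} {z : Fin 2 → ℤ} {x : Plane}
    (hx : x ∈ segment ℝ (d.tailPt + latticeVec z) (d.headPt + latticeVec z)) :
    ∃ s ∈ Set.Icc d.seg.lo d.seg.hi, x = L.pt d.seg.idx s + latticeVec z := by
  obtain ⟨t, ht, rfl⟩ := exists_mem_uIcc_of_mem_segment hx
  refine ⟨t, ?_, rfl⟩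
  have := d.seg.lt.le
  split_ifs at ht
  · rwa [Set.uIcc_of_le this] at ht
  · rwa [Set.uIcc_of_ge this] at ht

/-- This is the form, symmetric about the midpoint, in which `eventually_winding_ne` takes edges;
the sign of `k` records the direction of `d`. -/
theorem exists_symm (d : L.TEdge) : ∃ k : ℝ, k ≠ 0 ∧
    d.tailPt = L.pt d.seg.idx d.seg.mid - (1 / 2 : ℝ) • k • (L.b d.seg.idx - L.a d.seg.idx) ∧
    d.headPt = L.pt d.seg.idx d.seg.mid + (1 / 2 : ℝ) • k • (L.b d.seg.idx - L.a d.seg.idx) := by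
  have := d.seg.lt
  rcases hf : d.fwd with _ | _
  · refine ⟨d.seg.lo - d.seg.hi, by linarith, ?_, ?_⟩
    · rw [tailPt, hf]; simp only [pt_eq, Subsegment.mid]; ext k; simp; ring
    · rw [headPt, hf]; simp only [pt_eq, Subsegment.mid]; ext k; simp; ring
  · refine ⟨d.seg.hi - d.seg.lo, by linarith, ?_, ?_⟩
    · rw [tailPt, hf]; simp only [pt_eq, Subsegment.mid]; ext k; simp; ring
    · rw [headPt, hf]; simp only [pt_eq, Subsegment.mid]; ext k; simp; ring

theorem proj_headPt_mem (d : L.TEdge) : proj d.headPt ∈ L.vertexSet := by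
  unfold headPt
  split
  · exact d.seg.hi_mem.2
  · exact d.seg.lo_mem.2

theorem proj_tailPt_mem (d : L.TEdge) : proj d.tailPt ∈ L.vertexSet := d.src.2

theorem Lift.proj_mem {d : L.TEdge} {x y : Plane} (h : d.Lift x y) : proj x ∈ L.vertexSet := by
  obtain ⟨z, rfl, -⟩ := h
  rw [proj_add_latticeVec]
  exact d.proj_tailPt_mem

end TEdge

/-- There are finitely many vertices modulo the lattice, and finitely many translates of each in a
disc. This makes the descent terminate. -/
theorem finite_lifted_vertices (L : TorusTGraph n) (R : ℝ) :
    {x : Plane | proj x ∈ L.vertexSet ∧ ‖x‖ ≤ R}.Finite := by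
  have hsurj : ∀ v ∈ L.vertexSet, ∃ x : Plane, proj x = v := by
    rintro v ⟨i, rfl | rfl⟩
    exacts [⟨_, rfl⟩, ⟨_, rfl⟩]
  choose! f hf using hsurj
  refine (L.finite_vertexSet.biUnion fun v _ =>
    (finite_latticeVec_norm_le (f v) R).image fun z => f v + latticeVec z).subset ?_
  rintro x ⟨hx, hR⟩
  obtain ⟨z, hz⟩ := exists_add_latticeVec (hf _ hx)
  exact Set.mem_iUnion₂.2 ⟨proj x, hx, z,
    show ‖f (proj x) + latticeVec z‖ ≤ R by rw [← hz]; exact hR, hz.symm⟩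

/-- Around a lifted subsegment, one can leave the lifted graph in every transversal direction. -/
theorem Subsegment.eventually_notMem_cover (S : L.Subsegment) (z : Fin 2 → ℤ) {k : ℝ}
    (hk : k ≠ 0) : ∀ᶠ t : ℝ in 𝓝[>] 0,
      L.pt S.idx S.mid + latticeVec z + t • rot (k • (L.b S.idx - L.a S.idx)) ∉ L.cover := by
  have h := eventually_cross_eq_zero (S.Ioo_subset S.mid_mem) (S.consecutive _ S.mid_mem) z
  set c := L.pt S.idx S.mid + latticeVec z
  have hc : Filter.Tendsto
      (fun t : ℝ => c + t • rot (k • (L.b S.idx - L.a S.idx))) (𝓝[>] 0) (𝓝 c) := by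
    have : ContinuousAt (fun t : ℝ => c + t • rot (k • (L.b S.idx - L.a S.idx))) 0 := by fun_prop
    have h := this.tendsto
    simp only [zero_smul, add_zero] at h
    exact h.mono_left nhdsWithin_le_nhds
  filter_upwards [hc.eventually h, self_mem_nhdsWithin] with t ht ht0 hcov
  have h0 := ht hcov
  rw [add_sub_cancel_left, rot_smul, cross_smul_right, cross_smul_right] at h0
  have ht0 : (0 : ℝ) < t := ht0
  exact mul_ne_zero ht0.ne' (mul_ne_zero hk (cross_rot_pos (L.dir_ne_zero _)).ne') h0

variable {F : Set L.TEdge} {F' : Set L.DualDart}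

/-- Inside a contractible cycle of `F` there is a contractible cycle of `F'`. -/
theorem Complementary.exists_dual_cycle (h : Complementary F F') {R : ℝ} {x : Plane}
    (hx : Relation.TransGen
      (fun x y => (∃ d ∈ F, d.Lift x y) ∧ ‖x‖ ≤ R ∧ ‖y‖ ≤ R) x x) :
    ∃ A : Set L.LiftedFace, (∀ P ∈ A, ∀ y ∈ P.1, ‖y‖ < R) ∧ ∃ Q,
      Relation.TransGen (fun P P' => P ∈ A ∧ P' ∈ A ∧ ∃ d ∈ F', d.Lift P P') Q Q := by
  obtain ⟨y, hxy, hyx⟩ := Relation.TransGen.head'_iff.1 hx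
  obtain ⟨l₀, hl₀, hR₀⟩ := exists_path_of_reflTransGen hyx
  set l := (x, y) :: l₀ with hl_def
  have hl : IsPath x l x := ⟨rfl, hl₀⟩
  have hR : ∀ e ∈ l, (∃ d ∈ F, d.Lift e.1 e.2) ∧ ‖e.1‖ ≤ R ∧ ‖e.2‖ ≤ R := by
    rw [hl_def]
    simp only [List.mem_cons, forall_eq_or_imp]
    exact ⟨hxy, hR₀⟩
  have hseg : ∀ e ∈ l, ∀ u ∈ segment ℝ e.1 e.2, ∃ d ∈ F, ∃ z,
      e = (d.tailPt + latticeVec z, d.headPt + latticeVec z) ∧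
      ∃ s ∈ Set.Icc d.seg.lo d.seg.hi, u = L.pt d.seg.idx s + latticeVec z := by
    intro e he u hu
    obtain ⟨⟨d, hd, z, h1, h2⟩, -⟩ := hR e he
    rw [h1, h2] at hu
    exact ⟨d, hd, z, Prod.ext h1 h2, TEdge.exists_of_mem_segment hu⟩
  have hoff : ∀ u ∈ L.coverᶜ, ∀ e ∈ l, u ∉ segment ℝ e.1 e.2 := by
    intro u hu e he hue
    obtain ⟨d, -, z, -, s, hs, rfl⟩ := hseg e he u hue
    exact hu (mem_cover_of_mem_Icc (d.seg.Icc_subset hs) z)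
  -- The path stays in the lifted graph, so its winding number is a function of the lifted face.
  have hconst : ∀ P : L.LiftedFace, ∀ u ∈ P.1, ∀ w ∈ P.1, winding l u = winding l w :=
    fun P u hu w hw => winding_eq_of_isPreconnected hl P.isPreconnected
      (fun a ha => hoff a (P.subset ha)) hu hw
  -- the closed path winds around the points on one side of its first edge
  have hne : ∃ u ∈ L.coverᶜ, winding l u ≠ 0 := by
    obtain ⟨⟨d, hd, z, hdx, hdy⟩, -⟩ := hxy
    obtain ⟨k, hk, htail, hhead⟩ := d.exists_symm
    set c := L.pt d.seg.idx d.seg.mid + latticeVec z with hc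
    set v := k • (L.b d.seg.idx - L.a d.seg.idx) with hv
    have hv0 : v ≠ 0 := smul_ne_zero hk (L.dir_ne_zero _)
    have he : (d.tailPt + latticeVec z, d.headPt + latticeVec z) =
        (c - (1 / 2 : ℝ) • v, c + (1 / 2 : ℝ) • v) := by
      rw [htail, hhead, hc]
      exact Prod.ext (by simp only; abel) (by simp only; abel)
    -- The midpoint `c` lies on no other lifted subsegment, and `F` uses this one in one direction
    -- only, so the path passes `c` always in the same way.
    have hjump := eventually_winding_ne (c := c) hv0 (l := l) (by
      intro e hel
      by_cases hce : c ∈ segment ℝ e.1 e.2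
      · left
        obtain ⟨d', hd', z', rfl, s, hs, hcs⟩ := hseg e hel c hce
        obtain ⟨h1, -, rfl⟩ := Subsegment.lifted_eq d.seg.mid_mem hs hcs
        obtain rfl := h.edge_eq d hd d' hd' h1
        exact ⟨1 / 2, by norm_num, he⟩
      · exact Or.inr hce) ⟨(x, y), by simp [hl_def], 1 / 2, by norm_num, by rw [hdx, hdy, he]⟩
    have h1 := d.seg.eventually_notMem_cover z hk
    have h2 := d.seg.eventually_notMem_cover z (neg_ne_zero.2 hk)
    obtain ⟨t, ⟨ht, ht1⟩, ht2⟩ := ((hjump.and h1).and h2).exists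
    rw [neg_smul, show -(k • (L.b d.seg.idx - L.a d.seg.idx)) = (-1 : ℝ) • v by
      rw [neg_one_smul], rot_smul, neg_one_smul, smul_neg, ← sub_eq_add_neg] at ht2
    by_cases hw : winding l (c + t • rot v) = 0
    · exact ⟨_, ht2, fun h0 => ht (hw.trans h0.symm)⟩
    · exact ⟨_, ht1, hw⟩
  set A : Set L.LiftedFace := {P | ∀ u ∈ P.1, winding l u ≠ 0} with hA
  have hAne : A.Nonempty := by
    obtain ⟨u, hu, hw⟩ := hne
    refine ⟨liftedFaceAt u hu, fun w hw' => ?_⟩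
    rwa [hconst _ w hw' u (mem_liftedFaceAt u hu)]
  have hxR : ‖x‖ ≤ R := hxy.2.1
  have hnorm : ∀ u, (∀ e ∈ l, u ∉ segment ℝ e.1 e.2) → winding l u ≠ 0 → ‖u‖ < R :=
    fun u hu hw => norm_lt_of_winding_ne_zero hl hu hxR (fun e he => (hR e he).2.2) hw
  -- one can always leave a face of `A` along `F'`, staying in `A`
  have hstep : ∀ P ∈ A, ∃ P' ∈ A, ∃ d ∈ F', ∃ z,
      (∀ r ∈ Set.Ioo d.seg.lo d.seg.hi,
        L.Beside P.1 d.seg.idx d.side (L.pt d.seg.idx r + latticeVec z) ∧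
        L.Beside P'.1 d.seg.idx (!d.side) (L.pt d.seg.idx r + latticeVec z)) ∧
      ‖L.pt d.seg.idx d.seg.mid + latticeVec z‖ ≤ R := by
    intro P hP
    obtain ⟨φ, hφ⟩ := P.exists_face
    obtain ⟨d, hd, rfl⟩ := h.exists_dart φ
    obtain ⟨P', z, hz⟩ := d.exists_lift hφ
    set c := L.pt d.seg.idx d.seg.mid + latticeVec z with hc
    -- `F` does not use the subsegment crossed by `d`, so the path misses its midpoint and winds
    -- equally around the faces on both sides.
    have hcoff : ∀ e ∈ l, c ∉ segment ℝ e.1 e.2 := by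
      intro e he hce
      obtain ⟨d', hd', z', -, s, hs, hcs⟩ := hseg e he c hce
      exact h.seg_ne d' hd' d hd (Subsegment.lifted_eq d.seg.mid_mem hs hcs).1.symm
    have hev := eventually_winding_eq hl hcoff
    have hnear : ∀ σ, ∀ B : Set Plane, L.Beside B d.seg.idx σ c →
        ∃ u ∈ B, winding l u = winding l c := by
      intro σ B hB
      have hB' : L.Beside {u | winding l u = winding l c} d.seg.idx σ c := by
        filter_upwards [hev] with u hu _ using hu
      exact hB.inter_nonempty hB'
    obtain ⟨u, hu, huc⟩ := hnear _ _ (hz _ d.seg.mid_mem).1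
    obtain ⟨u', hu', huc'⟩ := hnear _ _ (hz _ d.seg.mid_mem).2
    have hcw : winding l c ≠ 0 := huc ▸ hP u hu
    refine ⟨P', fun w hw => ?_, d, hd, z, hz, (hnorm c hcoff hcw).le⟩
    rwa [hconst P' w hw u' hu', huc']
  -- Each lifted face in `A` lies beside a lifted midpoint of norm at most `R`, and is determined by
  -- that lift and the side.
  have hAfin : A.Finite := by
    choose g hg using fun (p : L.DualDart × (Fin 2 → ℤ)) =>
      exists_beside_subsegment p.1.seg p.1.side p.2
    have hfin : (⋃ d : L.DualDart, Prod.mk d ''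
        {z | ‖L.pt d.seg.idx d.seg.mid + latticeVec z‖ ≤ R}).Finite :=
      Set.finite_iUnion fun d => (finite_latticeVec_norm_le _ _).image _
    refine (hfin.image g).subset fun P hP => ?_
    obtain ⟨P', -, d, -, z, hz, hle⟩ := hstep P hP
    exact ⟨(d, z), Set.mem_iUnion.2 ⟨d, z, hle, rfl⟩,
      Beside.eq (hg (d, z) _ d.seg.mid_mem) (hz _ d.seg.mid_mem).1⟩
  refine ⟨A, fun P hP u hu => hnorm u (hoff u (P.subset hu)) (hP u hu), ?_⟩
  exact exists_cycle_of_finite hAfin hAne fun P hP => by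
    obtain ⟨P', hP', d, hd, z, hz, -⟩ := hstep P hP
    exact ⟨P', hP', d, hd, z, hz⟩

end TorusTGraph
end TGraph

namespace TGraph
namespace TorusTGraph

variable {n : ℕ} {L : TorusTGraph n} {F : Set L.TEdge} {F' : Set L.DualDart}

/-! ### Polygonal paths along dual edges, and the cycles they enclose -/

/-- A step of a polygonal path inside faces of `A`: a segment which either avoids the lifted graph
or crosses a lifted subsegment at its midpoint, in a direction given by `F'`. -/
def DualStep (F' : Set L.DualDart) (A : Set L.LiftedFace) (p q : Plane) : Prop :=
  ((∃ P ∈ A, p ∈ P.1) ∧ ∃ P ∈ A, q ∈ P.1) ∧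
    (segment ℝ p q ⊆ L.coverᶜ ∨ ∃ d ∈ F', ∃ z, ∃ s : ℝ, 0 < s ∧
      p = L.pt d.seg.idx d.seg.mid + latticeVec z - s • L.sideVec d.seg.idx (!d.side) ∧
      q = L.pt d.seg.idx d.seg.mid + latticeVec z + s • L.sideVec d.seg.idx (!d.side) ∧
      ∀ x ∈ segment ℝ p q, x ∈ L.cover → x = L.pt d.seg.idx d.seg.mid + latticeVec z)

/-- A lifted face is open and connected, hence polygonally connected; locally a single segment in a
disc is enough. -/
theorem reflTransGen_dualStep_of_mem {A : Set L.LiftedFace} {P : L.LiftedFace} (hP : P ∈ A)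
    {p q : Plane} (hp : p ∈ P.1) (hq : q ∈ P.1) :
    Relation.ReflTransGen (DualStep F' A) p q := by
  refine P.isPreconnected.induction₂' (fun p q => Relation.ReflTransGen (DualStep F' A) p q)
    ?_ (fun _ _ _ _ _ _ h1 h2 => h1.trans h2) hp hq
  intro x hx
  obtain ⟨ε, hε, hb⟩ := Metric.isOpen_iff.1 P.isOpen x hx
  refine mem_nhdsWithin_of_mem_nhds ?_
  filter_upwards [Metric.ball_mem_nhds x hε] with y hy
  have hxb := Metric.mem_ball_self (x := x) hε
  have hcov := hb.trans P.subset
  exact ⟨.single ⟨⟨⟨P, hP, hx⟩, ⟨P, hP, hb hy⟩⟩,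
      Or.inl (((convex_ball x ε).segment_subset hxb hy).trans hcov)⟩,
    .single ⟨⟨⟨P, hP, hb hy⟩, ⟨P, hP, hx⟩⟩,
      Or.inl (((convex_ball x ε).segment_subset hy hxb).trans hcov)⟩⟩

/-- A crossing is realized by a short perpendicular through the midpoint of the subsegment. One open
half of it lies in `P` and the other in `Q`, so it meets the graph in the midpoint only. -/
theorem exists_dualStep {A : Set L.LiftedFace} {P Q : L.LiftedFace} (hP : P ∈ A) (hQ : Q ∈ A)
    {d : L.DualDart} (hd : d ∈ F') (h : d.Lift P Q) :
    ∃ z, ∃ s : ℝ, 0 < s ∧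
      L.pt d.seg.idx d.seg.mid + latticeVec z - s • L.sideVec d.seg.idx (!d.side) ∈ P.1 ∧
      L.pt d.seg.idx d.seg.mid + latticeVec z + s • L.sideVec d.seg.idx (!d.side) ∈ Q.1 ∧
      DualStep F' A (L.pt d.seg.idx d.seg.mid + latticeVec z - s • L.sideVec d.seg.idx (!d.side))
        (L.pt d.seg.idx d.seg.mid + latticeVec z + s • L.sideVec d.seg.idx (!d.side)) := by
  obtain ⟨z, hz⟩ := h
  obtain ⟨h1, h2⟩ := hz _ d.seg.mid_mem
  set c := L.pt d.seg.idx d.seg.mid + latticeVec z with hc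
  set v := L.sideVec d.seg.idx (!d.side) with hv
  have hv' : L.sideVec d.seg.idx d.side = -v := by rw [hv, sideVec_not, neg_neg]
  obtain ⟨δ, hδ, hsub⟩ := mem_nhdsGT_iff_exists_Ioo_subset.1
    (h1.eventually_mem.and h2.eventually_mem)
  have hδ : 0 < δ := hδ
  have hP' : ∀ t, 0 < t → t < δ → c - t • v ∈ P.1 := by
    intro t h0 h1
    have := (hsub ⟨h0, h1⟩).1
    rwa [hv', smul_neg, ← sub_eq_add_neg] at this
  have hQ' : ∀ t, 0 < t → t < δ → c + t • v ∈ Q.1 := fun t h0 h1 => (hsub ⟨h0, h1⟩).2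
  have ha := hP' (δ / 2) (by linarith) (by linarith)
  have hb := hQ' (δ / 2) (by linarith) (by linarith)
  refine ⟨z, δ / 2, by linarith, ha, hb, ⟨⟨P, hP, ha⟩, ⟨Q, hQ, hb⟩⟩,
    Or.inr ⟨d, hd, z, δ / 2, by linarith, rfl, rfl, ?_⟩⟩
  rintro x ⟨α, β, hα, hβ, hαβ, rfl⟩ hx
  have hpt : α • (c - (δ / 2) • v) + β • (c + (δ / 2) • v) = c + ((β - α) * (δ / 2)) • v := by
    obtain rfl : α = 1 - β := by linarith
    ext k; simp; ring
  rw [hpt] at hx ⊢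
  -- The sign of the position along `v` decides between `P`, the midpoint and `Q`.
  rcases lt_trichotomy ((β - α) * (δ / 2)) 0 with h0 | h0 | h0
  · exfalso
    refine P.subset (hP' (-((β - α) * (δ / 2))) (by linarith) (by nlinarith)) ?_
    rwa [neg_smul, sub_neg_eq_add]
  · rw [h0, zero_smul, add_zero]
  · exact absurd hx (Q.subset (hQ' _ h0 (by nlinarith)))

theorem reflTransGen_dualStep {A : Set L.LiftedFace} {P Q : L.LiftedFace} (hP : P ∈ A)
    (h : Relation.ReflTransGen (fun P P' => P ∈ A ∧ P' ∈ A ∧ ∃ d ∈ F', d.Lift P P') P Q)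
    {p q : Plane} (hp : p ∈ P.1) (hq : q ∈ Q.1) :
    Relation.ReflTransGen (DualStep F' A) p q := by
  induction h generalizing q with
  | refl => exact reflTransGen_dualStep_of_mem hP hp hq
  | tail _ hstep ih =>
    obtain ⟨h1, h2, d, hd, hlift⟩ := hstep
    obtain ⟨z, s, -, ha, hb, hab⟩ := exists_dualStep h1 h2 hd hlift
    exact ((ih ha).tail hab).trans (reflTransGen_dualStep_of_mem h2 hb hq)

/-- Inside a contractible cycle of `F'` there is a contractible cycle of `F`. -/
theorem Complementary.exists_cycle (h : Complementary F F') {A : Set L.LiftedFace}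
    {Q : L.LiftedFace}
    (hQ : Relation.TransGen (fun P P' => P ∈ A ∧ P' ∈ A ∧ ∃ d ∈ F', d.Lift P P') Q Q) :
    ∃ P ∈ A, ∃ p ∈ P.1, ∃ v, Relation.TransGen
      (fun x y => (∃ d ∈ F, d.Lift x y) ∧ ‖x‖ ≤ ‖p‖ ∧ ‖y‖ ≤ ‖p‖) v v := by
  obtain ⟨Q', ⟨hQA, hQA', d₀, hd₀, hlift⟩, hQ'⟩ := Relation.TransGen.head'_iff.1 hQ
  obtain ⟨z₀, s₀, hs₀, ha, hb, hab⟩ := exists_dualStep hQA hQA' hd₀ hlift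
  set S := d₀.seg with hS
  set c := L.pt S.idx S.mid + latticeVec z₀ with hc
  set v := L.sideVec S.idx (!d₀.side) with hv
  obtain ⟨l₀, hl₀, hstep₀⟩ := exists_path_of_reflTransGen (reflTransGen_dualStep hQA' hQ' hb ha)
  set a := c - s₀ • v with ha_def
  set l := (a, c + s₀ • v) :: l₀ with hl_def
  have hl : IsPath a l a := ⟨rfl, hl₀⟩
  have hstep : ∀ e ∈ l, DualStep F' A e.1 e.2 := by
    rw [hl_def]
    simp only [List.mem_cons, forall_eq_or_imp]
    exact ⟨hab, hstep₀⟩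
  -- the farthest corner of the path
  obtain ⟨p, hp, hmax⟩ := Set.exists_max_image (insert a {x | x ∈ l.map Prod.snd}) norm
    ((List.finite_toSet _).insert a) ⟨a, Set.mem_insert _ _⟩
  have hpA : ∃ P ∈ A, p ∈ P.1 := by
    rcases hp with rfl | hp
    · exact ⟨Q, hQA, ha⟩
    · obtain ⟨e, he, rfl⟩ := List.mem_map.1 hp
      exact (hstep e he).1.2
  obtain ⟨P, hPA, hpP⟩ := hpA
  have hap : ‖a‖ ≤ ‖p‖ := hmax a (Set.mem_insert _ _)
  have hlp : ∀ e ∈ l, ‖e.2‖ ≤ ‖p‖ := fun e he =>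
    hmax _ (Set.mem_insert_of_mem _ (List.mem_map.2 ⟨e, he, rfl⟩))
  -- the path meets the lifted graph only in midpoints of subsegments crossed by `F'`
  have hmeet : ∀ e ∈ l, ∀ x ∈ segment ℝ e.1 e.2, x ∈ L.cover → ∃ d ∈ F', ∃ z, ∃ s : ℝ, 0 < s ∧
      e = (L.pt d.seg.idx d.seg.mid + latticeVec z - s • L.sideVec d.seg.idx (!d.side),
        L.pt d.seg.idx d.seg.mid + latticeVec z + s • L.sideVec d.seg.idx (!d.side)) ∧
      x = L.pt d.seg.idx d.seg.mid + latticeVec z := by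
    intro e he x hx hxc
    obtain ⟨-, h1 | ⟨d, hd, z, s, hs, h1, h2, h3⟩⟩ := hstep e he
    · exact absurd hxc (h1 hx)
    · exact ⟨d, hd, z, s, hs, Prod.ext h1 h2, h3 x hx hxc⟩
  have hoff : ∀ (T : L.Subsegment) (w : Fin 2 → ℤ), ∀ r ∈ Set.Icc T.lo T.hi,
      ((∃ d ∈ F', d.seg = T) → r ≠ T.mid) →
      ∀ e ∈ l, L.pt T.idx r + latticeVec w ∉ segment ℝ e.1 e.2 := by
    intro T w r hr hne e he hx
    obtain ⟨d, hd, z, s, -, -, hx'⟩ :=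
      hmeet e he _ hx (mem_cover_of_mem_Icc (T.Icc_subset hr) w)
    obtain ⟨h1, h2, -⟩ := Subsegment.lifted_eq d.seg.mid_mem hr hx'.symm
    exact hne ⟨d, hd, h1⟩ (by rw [← h2, h1])
  -- The path meets the graph only in midpoints of subsegments, and these are no vertices.
  have hoffv : ∀ x, proj x ∈ L.vertexSet → ∀ e ∈ l, x ∉ segment ℝ e.1 e.2 := by
    intro x hxv e he hx
    have hxc : x ∈ L.cover := by
      obtain ⟨i, r, hr, hir⟩ := exists_position hxv
      obtain ⟨z, rfl⟩ := exists_add_latticeVec hir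
      exact mem_cover_of_mem_Icc ⟨hr.1.le, hr.2.le⟩ z
    obtain ⟨d, hd, z, s, -, -, hx'⟩ := hmeet e he _ hx hxc
    refine d.seg.consecutive _ d.seg.mid_mem ⟨d.seg.Icc_subset ?_, ?_⟩
    · exact ⟨d.seg.mid_mem.1.le, d.seg.mid_mem.2.le⟩
    · rwa [hx', proj_add_latticeVec] at hxv
  have hnorm : ∀ x, proj x ∈ L.vertexSet → winding l x ≠ 0 → ‖x‖ ≤ ‖p‖ := fun x hx hw =>
    (norm_lt_of_winding_ne_zero hl (hoffv x hx) hap hlp hw).le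
  -- the path winds around an end of the subsegment crossed by its first edge
  have hend : ∃ x, proj x ∈ L.vertexSet ∧ winding l x ≠ 0 := by
    have hv0 : v ≠ 0 := by
      rintro h0
      have := cross_sideVec_pos L S.idx (!d₀.side)
      rw [← hv, h0] at this
      simp [cross] at this
    -- The normal to the crossing is the direction of `S`, so the jump compares two points of `S`
    -- itself, on either side of its midpoint.
    have hrot : rot v = sideSign d₀.side • (L.b S.idx - L.a S.idx) := by
      rw [hv, sideVec, rot_smul, rot_rot, sideSign_not, neg_smul, smul_neg, neg_neg]
    have hjump := eventually_winding_ne (c := c) hv0 (l := l) (by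
      intro e hel
      by_cases hce : c ∈ segment ℝ e.1 e.2
      · left
        have hcc : c ∈ L.cover :=
          mem_cover_of_mem_Icc (S.Icc_subset ⟨S.mid_mem.1.le, S.mid_mem.2.le⟩) z₀
        obtain ⟨d, hd, z, s, hs, rfl, hx'⟩ := hmeet e hel c hce hcc
        obtain ⟨h1, -, rfl⟩ := Subsegment.lifted_eq (S := S) (T := d.seg) S.mid_mem
          ⟨d.seg.mid_mem.1.le, d.seg.mid_mem.2.le⟩ hx'
        obtain rfl := h.dart_eq d₀ hd₀ d hd h1
        exact ⟨s, hs, rfl⟩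
      · exact Or.inr hce) ⟨(a, c + s₀ • v), by simp [hl_def], s₀, hs₀, rfl⟩
    have hsmall : ∀ᶠ t : ℝ in 𝓝[>] 0, t < (S.hi - S.lo) / 2 :=
      nhdsWithin_le_nhds (gt_mem_nhds (by linarith [S.lt]))
    obtain ⟨t, ⟨ht, ht1⟩, ht0⟩ := ((hjump.and hsmall).and self_mem_nhdsWithin).exists
    have ht0 : 0 < t := ht0
    have hpt : ∀ u : ℝ, c + u • (L.b S.idx - L.a S.idx) =
        L.pt S.idx (S.mid + u) + latticeVec z₀ := by
      intro u
      rw [hc, pt_eq, pt_eq, add_smul]; abel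
    have hcase : winding l (L.pt S.idx (S.mid + t) + latticeVec z₀) ≠
        winding l (L.pt S.idx (S.mid + -t) + latticeVec z₀) := by
      rw [← hpt, ← hpt]
      rw [hrot] at ht
      rcases hside : d₀.side with _ | _
      · have hsgn : sideSign d₀.side = -1 := by rw [hside]; simp [sideSign]
        rw [hsgn, neg_one_smul, smul_neg, sub_neg_eq_add, ← neg_smul] at ht
        exact ht.symm
      · have hsgn : sideSign d₀.side = 1 := by rw [hside]; simp [sideSign]
        rw [hsgn, one_smul] at ht
        rwa [neg_smul, ← sub_eq_add_neg]
    have hmid : S.mid = (S.lo + S.hi) / 2 := rfl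
    -- At least one of the two points has nonzero winding number; slide it along its half of `S` to
    -- the end of `S`, away from the midpoint and hence off the path.
    by_cases hw : winding l (L.pt S.idx (S.mid + t) + latticeVec z₀) = 0
    · refine ⟨L.pt S.idx S.lo + latticeVec z₀, by rw [proj_add_latticeVec]; exact S.lo_mem.2, ?_⟩
      have : winding l (L.pt S.idx S.lo + latticeVec z₀) =
          winding l (L.pt S.idx (S.mid + -t) + latticeVec z₀) := by
        refine winding_eq_of_isPreconnected hl
          (S.isPreconnected_lift z₀ (isPreconnected_Icc (a := S.lo) (b := S.mid + -t))) ?_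
          ⟨_, ⟨le_rfl, by linarith⟩, rfl⟩ ⟨_, ⟨by linarith, le_rfl⟩, rfl⟩
        rintro _ ⟨r, hr, rfl⟩
        exact hoff S z₀ r ⟨hr.1, by linarith [hr.2, S.lt]⟩ fun _ => by linarith [hr.2]
      rw [this]
      exact fun h0 => hcase (hw.trans h0.symm)
    · refine ⟨L.pt S.idx S.hi + latticeVec z₀, by rw [proj_add_latticeVec]; exact S.hi_mem.2, ?_⟩
      have : winding l (L.pt S.idx S.hi + latticeVec z₀) =
          winding l (L.pt S.idx (S.mid + t) + latticeVec z₀) := by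
        refine winding_eq_of_isPreconnected hl
          (S.isPreconnected_lift z₀ (isPreconnected_Icc (a := S.mid + t) (b := S.hi))) ?_
          ⟨_, ⟨by linarith, le_rfl⟩, rfl⟩ ⟨_, ⟨le_rfl, by linarith⟩, rfl⟩
        rintro _ ⟨r, hr, rfl⟩
        refine hoff S z₀ r ⟨by linarith [hr.1, S.lt], hr.2⟩ fun _ => ?_
        have := hr.1
        intro h0
        linarith
      rwa [this]
  obtain ⟨x₁, hx₁⟩ := hend
  have hfin : {x | proj x ∈ L.vertexSet ∧ winding l x ≠ 0}.Finite :=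
    (L.finite_lifted_vertices ‖p‖).subset fun x hx => ⟨hx.1, hnorm x hx.1 hx.2⟩
  -- The edge of `F` leaving an enclosed vertex follows a subsegment not crossed by `F'`; the path
  -- misses it, so its other end is enclosed too.
  obtain ⟨x, hx⟩ := exists_cycle_of_finite (r := fun x y => ∃ d ∈ F, d.Lift x y) hfin ⟨x₁, hx₁⟩ (by
    rintro x ⟨hxv, hxw⟩
    obtain ⟨d, hd, hdv⟩ := h.exists_edge ⟨proj x, hxv⟩
    obtain ⟨z, rfl⟩ := exists_add_latticeVec
      (show proj d.tailPt = proj x from congrArg Subtype.val hdv)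
    refine ⟨d.headPt + latticeVec z, ⟨?_, ?_⟩, d, hd, z, rfl, rfl⟩
    · rw [proj_add_latticeVec]; exact d.proj_headPt_mem
    · have hmem : ∀ r ∈ ({d.seg.lo, d.seg.hi} : Set ℝ), r ∈ Set.Icc d.seg.lo d.seg.hi := by
        rintro r (rfl | rfl)
        exacts [⟨le_rfl, d.seg.lt.le⟩, ⟨d.seg.lt.le, le_rfl⟩]
      have heq : winding l (d.headPt + latticeVec z) = winding l (d.tailPt + latticeVec z) := by
        refine winding_eq_of_isPreconnected hl
          (d.seg.isPreconnected_lift z (isPreconnected_Icc (a := d.seg.lo) (b := d.seg.hi))) ?_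
          ⟨_, hmem _ ?_, rfl⟩ ⟨_, hmem _ ?_, rfl⟩
        · rintro _ ⟨r, hr, rfl⟩
          exact hoff d.seg z r hr fun ⟨d', hd', h'⟩ => absurd h'.symm (h.seg_ne d hd d' hd')
        · split_ifs <;> simp
        · split_ifs <;> simp
      rwa [heq])
  refine ⟨P, hPA, p, hpP, x, Relation.TransGen.mono ?_ _ _ hx⟩
  rintro x y ⟨h1, h2, h3⟩
  exact ⟨h3, hnorm x h1.1 h1.2, hnorm y h2.1 h2.2⟩

/-! ### The infinite descent -/

/-- Passing from `F` to `F'` and back turns a cycle in the disc of radius `R` into one in a strictly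
smaller disc. -/
theorem Complementary.no_bounded_cycle (h : Complementary F F') (R : ℝ) (x : Plane) :
    ¬ Relation.TransGen (fun x y => (∃ d ∈ F, d.Lift x y) ∧ ‖x‖ ≤ R ∧ ‖y‖ ≤ R) x x := by
  intro hx
  let bad : ℝ → Prop := fun R => ∃ x, Relation.TransGen
    (fun x y => (∃ d ∈ F, d.Lift x y) ∧ ‖x‖ ≤ R ∧ ‖y‖ ≤ R) x x
  have hdesc : ∀ R, bad R → ∃ R' < R, bad R' := by
    rintro R ⟨x, hx⟩
    obtain ⟨A, hA, Q, hQ⟩ := h.exists_dual_cycle hx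
    obtain ⟨P, hP, p, hp, hv⟩ := h.exists_cycle hQ
    exact ⟨‖p‖, hA P hP p hp, hv⟩
  -- A real radius could decrease forever. But it can be shrunk to the norm of a farthest lifted
  -- vertex in the disc, and only finitely many such norms occur.
  have hattain : ∀ R, bad R → ∃ x, (proj x ∈ L.vertexSet ∧ ‖x‖ ≤ R) ∧ bad ‖x‖ := by
    rintro R ⟨x, hx⟩
    have hne : {x : Plane | proj x ∈ L.vertexSet ∧ ‖x‖ ≤ R}.Nonempty := by
      obtain ⟨y, ⟨⟨d, -, hd⟩, h1, -⟩, -⟩ := Relation.TransGen.head'_iff.1 hx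
      exact ⟨x, hd.proj_mem, h1⟩
    obtain ⟨m, hm, hmax⟩ := Set.exists_max_image _ norm (L.finite_lifted_vertices R) hne
    refine ⟨m, hm, x, Relation.TransGen.mono ?_ _ _ hx⟩
    rintro x y ⟨⟨d, hd, hl⟩, h1, h2⟩
    refine ⟨⟨d, hd, hl⟩, hmax x ⟨hl.proj_mem, h1⟩, hmax y ⟨?_, h2⟩⟩
    obtain ⟨z, -, rfl⟩ := hl
    rw [proj_add_latticeVec]
    exact d.proj_headPt_mem
  have hfin : {x : Plane | (proj x ∈ L.vertexSet ∧ ‖x‖ ≤ R) ∧ bad ‖x‖}.Finite :=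
    (L.finite_lifted_vertices R).subset fun x hx => hx.1
  obtain ⟨m, hm, hmin⟩ := Set.exists_min_image _ norm hfin (hattain R ⟨x, hx⟩)
  obtain ⟨R', hR', hbad⟩ := hdesc _ hm.2
  obtain ⟨x', hx', hbad'⟩ := hattain R' hbad
  exact absurd (hmin x' ⟨⟨hx'.1, hx'.2.trans (hR'.le.trans hm.1.2)⟩, hbad'⟩)
    (not_le.2 (hx'.2.trans_lt hR'))

/-- A cycle has finitely many points, so it is bounded. -/
theorem Complementary.no_cycle (h : Complementary F F') (x : Plane) :
    ¬ Relation.TransGen (fun x y => ∃ d ∈ F, d.Lift x y) x x := by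
  have key : ∀ x y, Relation.TransGen (fun x y => ∃ d ∈ F, d.Lift x y) x y →
      ∃ R, Relation.TransGen (fun x y => (∃ d ∈ F, d.Lift x y) ∧ ‖x‖ ≤ R ∧ ‖y‖ ≤ R) x y := by
    intro x y hxy
    induction hxy with
    | single h => exact ⟨max ‖x‖ ‖_‖, .single ⟨h, le_max_left _ _, le_max_right _ _⟩⟩
    | @tail b c _ h ih =>
      obtain ⟨R, hR⟩ := ih
      refine ⟨max R (max ‖b‖ ‖c‖), .tail (Relation.TransGen.mono ?_ _ _ hR) ⟨h, ?_, ?_⟩⟩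
      · exact fun _ _ h => ⟨h.1, le_max_of_le_left h.2.1, le_max_of_le_left h.2.2⟩
      · exact le_max_of_le_right (le_max_left _ _)
      · exact le_max_of_le_right (le_max_right _ _)
  intro hx
  obtain ⟨R, hR⟩ := key x x hx
  exact h.no_bounded_cycle R x hR

/-- A dual cycle would enclose a bounded cycle of `F`; no bound on the dual cycle is needed, hence
`A := Set.univ`. -/
theorem Complementary.no_dual_cycle (h : Complementary F F') (Q : L.LiftedFace) :
    ¬ Relation.TransGen (fun P P' => ∃ d ∈ F', d.Lift P P') Q Q := by
  intro hQ
  obtain ⟨P, -, p, -, v, hv⟩ := h.exists_cycle (A := Set.univ) (Q := Q)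
    (Relation.TransGen.mono (fun _ _ h => ⟨trivial, trivial, h⟩) _ _ hQ)
  exact h.no_bounded_cycle _ v hv

end TorusTGraph
end TGraph

namespace TGraph
namespace TorusTGraph

variable {n : ℕ} {L : TorusTGraph n}

/-! ### Edges going out of a vertex -/

namespace TEdge

/-- The parameter of the starting point of a directed edge. -/
def tail (d : L.TEdge) : ℝ := if d.fwd then d.seg.lo else d.seg.hi

theorem tail_mem_breaks (d : L.TEdge) : d.tail ∈ L.breaks d.seg.idx := by
  unfold tail; split
  · exact d.seg.lo_mem
  · exact d.seg.hi_mem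

theorem eq_of_seg_fwd {d d' : L.TEdge} (h1 : d.seg = d'.seg) (h2 : d.fwd = d'.fwd) : d = d' := by
  cases d; cases d'; simp only at h1 h2; subst h1; subst h2; rfl

theorem position_of_src_eq {d : L.TEdge} {i : Fin n} {r : ℝ} (hr : r ∈ Set.Ioo (0 : ℝ) 1)
    (h : d.src.1 = proj (L.pt i r)) : d.seg.idx = i ∧ d.tail = r :=
  position_unique d.interior hr h

theorem src_eq {d : L.TEdge} {v : L.Vertex} {i : Fin n} {r : ℝ} (hv : proj (L.pt i r) = v.1)
    (hi : d.seg.idx = i) (hr : d.tail = r) : d.src = v := by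
  apply Subtype.ext
  rw [← hv, ← hi, ← hr]; rfl

end TEdge

/-- Using a subsegment back and forth is a null-homotopic cycle of `𝒢_T`. -/
theorem IsForest.edge_eq {F : Finset L.TEdge} (hF : L.IsForest F) {d d' : L.TEdge} (hd : d ∈ F)
    (hd' : d' ∈ F) (h : d.seg = d'.seg) : d = d' := by
  by_contra hne
  have hf : d'.fwd = !d.fwd := by
    have : d.fwd ≠ d'.fwd := fun h' => hne (TEdge.eq_of_seg_fwd h h')
    revert this; cases d.fwd <;> cases d'.fwd <;> simp
  have h1 : d'.tailPt = d.headPt := by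
    rw [TEdge.tailPt, TEdge.headPt, ← h, hf]; cases d.fwd <;> rfl
  have h2 : d'.headPt = d.tailPt := by
    rw [TEdge.tailPt, TEdge.headPt, ← h, hf]; cases d.fwd <;> rfl
  refine hF.2 (d.tailPt + latticeVec 0) ?_
  refine .tail (.single ⟨d, hd, 0, rfl, rfl⟩) ⟨d', hd', 0, ?_, ?_⟩
  · rw [h1]
  · rw [h2]

theorem IsDualForest.dart_eq {F' : Finset L.DualDart} (hF' : L.IsDualForest F') {d d' : L.DualDart}
    (hd : d ∈ F') (hd' : d' ∈ F') (h : d.seg = d'.seg) : d = d' := by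
  by_contra hne
  have hf : d.side = !d'.side := by
    have : d.side ≠ d'.side := fun h' => hne (DualDart.eq_of_seg_side h h')
    revert this; cases d.side <;> cases d'.side <;> simp
  obtain ⟨P, Q, h1, h2⟩ := DualDart.exists_two_cycle h hf
  have hstep : ∃ e ∈ F', e.Lift Q P := ⟨d', hd', h2⟩
  exact hF'.2 P (.tail (.single ⟨d, hd, h1⟩) hstep)

/-- A forest of `𝒢_T` leaves exactly one subsegment of each complete edge unused. -/
theorem IsForest.exists_unique_unused {F : Finset L.TEdge} (hF : L.IsForest F) (i : Fin n) :
    ∃! S : L.Subsegment, S.idx = i ∧ ¬ ∃ d ∈ F, d.seg = S := by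
  -- Subsegments correspond to their lower ends, which form `B`; edges of `F` on the complete edge
  -- correspond to their tails, which form `B \ {0}`. The difference of the cardinalities is `1`.
  set B : Set ℝ := L.breaks i ∩ Set.Iio 1 with hB
  have hBfin : B.Finite := (finite_breaks i).inter_of_left _
  set segs : Set L.Subsegment := {S | S.idx = i} with hsegs
  set edges : Set L.TEdge := {d | d ∈ F ∧ d.seg.idx = i} with hedges
  have h1 : segs.ncard = B.ncard := by
    have himg : Subsegment.lo '' segs = B := by
      ext r
      constructor
      · rintro ⟨S, hS, rfl⟩
        have hS : S.idx = i := hS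
        exact ⟨hS ▸ S.lo_mem, S.lt.trans_le S.hi_le_one⟩
      · rintro ⟨hr, hr1⟩
        obtain ⟨S, h1, h2⟩ := exists_subsegment_lo hr hr1
        exact ⟨S, h1, h2⟩
    rw [← himg, Set.InjOn.ncard_image]
    intro S hS T hT h
    have hS : S.idx = i := hS
    have hT : T.idx = i := hT
    exact Subsegment.eq_of_lo (hS.trans hT.symm) h
  have h2 : edges.ncard = (B \ {0}).ncard := by
    have himg : TEdge.tail '' edges = B \ {0} := by
      ext r
      constructor
      · rintro ⟨d, ⟨-, hd⟩, rfl⟩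
        have hmem : d.tail ∈ Set.Ioo (0 : ℝ) 1 := d.interior
        exact ⟨⟨hd ▸ d.tail_mem_breaks, hmem.2⟩, hmem.1.ne'⟩
      · rintro ⟨⟨hr, hr1⟩, hr0⟩
        have hrI : r ∈ Set.Ioo (0 : ℝ) 1 := ⟨lt_of_le_of_ne hr.1.1 (Ne.symm hr0), hr1⟩
        obtain ⟨d, ⟨hd, hdv⟩, -⟩ := hF.1 ⟨proj (L.pt i r), hr.2⟩
        obtain ⟨h3, h4⟩ := TEdge.position_of_src_eq hrI (congrArg Subtype.val hdv)
        exact ⟨d, ⟨hd, h3⟩, h4⟩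
    rw [← himg, Set.InjOn.ncard_image]
    rintro d ⟨hd, hdi⟩ d' ⟨hd', hdi'⟩ h
    exact (hF.1 d'.src).unique ⟨hd, TEdge.src_eq (v := d'.src) rfl (hdi.trans hdi'.symm) h⟩
      ⟨hd', rfl⟩
  have h3 : (TEdge.seg '' edges).ncard = edges.ncard := by
    rw [Set.InjOn.ncard_image]
    rintro d ⟨hd, -⟩ d' ⟨hd', -⟩ h
    exact hF.edge_eq hd hd' h
  have h0 : (0 : ℝ) ∈ B := ⟨zero_mem_breaks i, show (0 : ℝ) < 1 from one_pos⟩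
  have h4 : (B \ {0}).ncard + 1 = B.ncard := Set.ncard_sdiff_singleton_add_one h0 hBfin
  have hsub : TEdge.seg '' edges ⊆ segs := by
    rintro _ ⟨d, hd, rfl⟩
    exact hd.2
  have h5 : (segs \ (TEdge.seg '' edges)).ncard = 1 := by
    rw [Set.ncard_sdiff hsub (Set.toFinite _)]; omega
  obtain ⟨S, hS⟩ := Set.ncard_eq_one.1 h5
  have hiff : ∀ T : L.Subsegment, (T.idx = i ∧ ¬ ∃ d ∈ F, d.seg = T) ↔ T = S := by
    intro T
    rw [show T = S ↔ T ∈ ({S} : Set L.Subsegment) from Iff.rfl, ← hS]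
    constructor
    · rintro ⟨h1, h2⟩
      exact ⟨h1, fun ⟨d, hd, hdT⟩ => h2 ⟨d, hd.1, hdT⟩⟩
    · rintro ⟨h1, h2⟩
      refine ⟨h1, fun ⟨d, hd, hdT⟩ => h2 ⟨d, ⟨hd, ?_⟩, hdT⟩⟩
      rw [hdT]; exact h1
  exact ⟨S, (hiff S).2 rfl, fun T hT => (hiff T).1 hT⟩

/-! ### The forest directed away from marked subsegments -/

/-- The directed edges of `𝒢_T` pointing away from the marked subsegment of their complete edge. -/
def awayForest (m : Fin n → L.Subsegment) : Set L.TEdge :=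
  {d | if d.fwd then (m d.seg.idx).hi ≤ d.seg.lo else d.seg.hi ≤ (m d.seg.idx).lo}

theorem mem_awayForest_fwd {m : Fin n → L.Subsegment} {d : L.TEdge} (h : d.fwd = true) :
    d ∈ awayForest m ↔ (m d.seg.idx).hi ≤ d.seg.lo := by
  simp [awayForest, h]

theorem mem_awayForest_bwd {m : Fin n → L.Subsegment} {d : L.TEdge} (h : d.fwd = false) :
    d ∈ awayForest m ↔ d.seg.hi ≤ (m d.seg.idx).lo := by
  simp [awayForest, h]

/-- A vertex on a complete edge is not inside the marked subsegment, so it lies on one side of it,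
and only one of its two outgoing edges points away. -/
theorem existsUnique_awayForest {m : Fin n → L.Subsegment} (hm : ∀ i, (m i).idx = i)
    (v : L.Vertex) : ∃! d, d ∈ awayForest m ∧ d.src = v := by
  obtain ⟨i, r, hr, hv⟩ := exists_position v.2
  have hrb : r ∈ L.breaks i := ⟨⟨hr.1.le, hr.2.le⟩, hv ▸ v.2⟩
  have hlt := (m i).lt
  have hpos : ∀ d : L.TEdge, d.src = v → d.seg.idx = i ∧ d.tail = r := fun d hd =>
    TEdge.position_of_src_eq hr (by rw [hd, hv])
  by_cases hhi : (m i).hi ≤ r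
  · obtain ⟨S, rfl, rfl⟩ := exists_subsegment_lo hrb hr.2
    refine ⟨⟨S, true, by simpa using hr⟩, ⟨(mem_awayForest_fwd rfl).2 hhi,
      TEdge.src_eq hv rfl rfl⟩, ?_⟩
    rintro d ⟨hd, hdv⟩
    obtain ⟨h1, h2⟩ := hpos d hdv
    rcases hf : d.fwd with _ | _
    · rw [mem_awayForest_bwd hf, h1] at hd
      simp only [TEdge.tail, hf] at h2
      have h2 : d.seg.hi = S.lo := h2
      linarith
    · simp only [TEdge.tail, hf] at h2
      exact TEdge.eq_of_seg_fwd (Subsegment.eq_of_lo h1 h2) hf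
  · have hlo : r ≤ (m i).lo := by
      by_contra! h
      exact (m i).consecutive r ⟨h, not_le.1 hhi⟩ (by rw [hm]; exact hrb)
    obtain ⟨S, rfl, rfl⟩ := exists_subsegment_hi hrb hr.1
    refine ⟨⟨S, false, by simpa using hr⟩, ⟨(mem_awayForest_bwd rfl).2 hlo,
      TEdge.src_eq hv rfl rfl⟩, ?_⟩
    rintro d ⟨hd, hdv⟩
    obtain ⟨h1, h2⟩ := hpos d hdv
    rcases hf : d.fwd with _ | _
    · simp only [TEdge.tail, hf] at h2
      exact TEdge.eq_of_seg_fwd (Subsegment.eq_of_hi h1 h2) hf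
    · rw [mem_awayForest_fwd hf, h1] at hd
      simp only [TEdge.tail, hf] at h2
      have h2 : d.seg.lo = S.hi := h2
      linarith

/-- An unmarked subsegment lies entirely on one side of the mark. Its end nearer to the mark is an
interior point of the complete edge, so it can be the tail of a directed edge. -/
theorem exists_mem_awayForest_iff {m : Fin n → L.Subsegment} (hm : ∀ i, (m i).idx = i)
    (S : L.Subsegment) : (∃ d ∈ awayForest m, d.seg = S) ↔ S ≠ m S.idx := by
  have hlt := (m S.idx).lt
  constructor
  · rintro ⟨d, hd, rfl⟩ h
    have h1 := congrArg Subsegment.lo h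
    have h2 := congrArg Subsegment.hi h
    rcases hf : d.fwd with _ | _
    · rw [mem_awayForest_bwd hf] at hd
      linarith
    · rw [mem_awayForest_fwd hf] at hd
      linarith
  · intro hne
    rcases Subsegment.eq_or_disjoint (hm S.idx).symm with h | h | h
    · exact absurd h hne
    · refine ⟨⟨S, false, ?_⟩, (mem_awayForest_bwd rfl).2 h, rfl⟩
      have h1 : 0 < S.hi := S.lo_nonneg.trans_lt S.lt
      have h2 : S.hi < 1 := h.trans_lt (hlt.trans_le (m S.idx).hi_le_one)
      simpa using ⟨h1, h2⟩
    · refine ⟨⟨S, true, ?_⟩, (mem_awayForest_fwd rfl).2 h, rfl⟩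
      have h1 : 0 < S.lo := ((m S.idx).lo_nonneg.trans_lt hlt).trans_le h
      have h2 : S.lo < 1 := S.lt.trans_le S.hi_le_one
      simpa using ⟨h1, h2⟩

theorem awayForest_edge_eq {m : Fin n → L.Subsegment} {d d' : L.TEdge} (hd : d ∈ awayForest m)
    (hd' : d' ∈ awayForest m) (h : d.seg = d'.seg) : d = d' := by
  have hlt := (m d.seg.idx).lt
  have hS := d.seg.lt
  refine TEdge.eq_of_seg_fwd h ?_
  rcases hf : d.fwd with _ | _ <;> rcases hf' : d'.fwd with _ | _
  · rfl
  · rw [mem_awayForest_bwd hf] at hd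
    rw [mem_awayForest_fwd hf', ← h] at hd'
    linarith
  · rw [mem_awayForest_fwd hf] at hd
    rw [mem_awayForest_bwd hf', ← h] at hd'
    linarith
  · rfl

/-! ### Edges of the dimer graph -/

theorem isOpen_sideSet (φ : L.Face) (i : Fin n) (σ : Bool) : IsOpen (L.sideSet φ i σ) := by
  refine isOpen_iff_mem_nhds.2 ?_
  rintro r ⟨hr, hB⟩
  rw [← add_zero (L.pt i r)] at hB
  filter_upwards [isOpen_Ioo.mem_nhds hr, hB.eventually] with s hs h
  rw [add_zero] at h
  exact ⟨hs, h⟩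

/-- The ends of a portion do not border the face from this side, so no end of one portion can lie
inside an overlapping one. -/
theorem DimerEdge.eq_of_mem {e e' : L.DimerEdge} (hf : e.face = e'.face) (hi : e.idx = e'.idx)
    (hs : e.side = e'.side) {r : ℝ} (h : r ∈ Set.Ioo e.lo e.hi) (h' : r ∈ Set.Ioo e'.lo e'.hi) :
    e = e' := by
  obtain ⟨φ, i, σ, lo, hi, hlt, hb, hlo, hhi⟩ := e
  obtain ⟨φ', i', σ', lo', hi', hlt', hb', hlo', hhi'⟩ := e'
  simp only at hf hi hs h h'
  subst hf hi hs
  obtain rfl : lo = lo' := by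
    rcases lt_trichotomy lo lo' with hl | hl | hl
    · exact absurd (hb ⟨hl, h'.1.trans h.2⟩) hlo'
    · exact hl
    · exact absurd (hb' ⟨hl, h.1.trans h'.2⟩) hlo
  have hhi_eq : hi = hi' := by
    rcases lt_trichotomy hi hi' with hl | hl | hl
    · exact absurd (hb' ⟨h'.1.trans h.2, hl⟩) hhi
    · exact hl
    · exact absurd (hb ⟨h.1.trans h'.2, hl⟩) hhi'
  subst hhi_eq
  rfl

/-- The edge of the dimer graph containing the subsegment crossed by a directed dual edge. -/
theorem DualDart.exists_dimerEdge (d : L.DualDart) : ∃ e : L.DimerEdge, e.face = d.src ∧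
    e.idx = d.seg.idx ∧ e.side = d.side ∧ e.lo ≤ d.seg.lo ∧ d.seg.hi ≤ e.hi := by
  set s := L.sideSet d.src d.seg.idx d.side with hs
  have hsc : IsClosed sᶜ := (isOpen_sideSet _ _ _).isClosed_compl
  have hmid := d.seg.mid_mem
  -- The maximal portion ends at the nearest points on either side of the midpoint which do not
  -- border the face. They exist because that set is closed and contains `0` and `1`.
  have h0 : (0 : ℝ) ∈ Set.Iic d.seg.mid ∩ sᶜ :=
    ⟨(d.seg.Ioo_subset hmid).1.le, fun h => lt_irrefl _ h.1.1⟩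
  have h1 : (1 : ℝ) ∈ Set.Ici d.seg.mid ∩ sᶜ :=
    ⟨(d.seg.Ioo_subset hmid).2.le, fun h => lt_irrefl _ h.1.2⟩
  have hba : BddAbove (Set.Iic d.seg.mid ∩ sᶜ) := ⟨d.seg.mid, fun r hr => hr.1⟩
  have hbb : BddBelow (Set.Ici d.seg.mid ∩ sᶜ) := ⟨d.seg.mid, fun r hr => hr.1⟩
  have hlo := (isClosed_Iic.inter hsc).csSup_mem ⟨0, h0⟩ hba
  have hhi := (isClosed_Ici.inter hsc).csInf_mem ⟨1, h1⟩ hbb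
  set lo := sSup (Set.Iic d.seg.mid ∩ sᶜ) with hlo_def
  set hi := sInf (Set.Ici d.seg.mid ∩ sᶜ) with hhi_def
  have hle1 : lo ≤ d.seg.lo := by
    by_contra! h
    exact hlo.2 (d.src_spec ⟨h, lt_of_le_of_lt hlo.1 hmid.2⟩)
  have hle2 : d.seg.hi ≤ hi := by
    by_contra! h
    exact hhi.2 (d.src_spec ⟨lt_of_lt_of_le hmid.1 hhi.1, h⟩)
  refine ⟨⟨d.src, d.seg.idx, d.side, lo, hi, by linarith [d.seg.lt], ?_, hlo.2, hhi.2⟩,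
    rfl, rfl, rfl, hle1, hle2⟩
  intro r hr
  by_contra hrs
  rcases le_total r d.seg.mid with h | h
  · exact absurd (le_csSup hba ⟨h, hrs⟩) (not_le.2 hr.1)
  · exact absurd (csInf_le hbb ⟨h, hrs⟩) (not_le.2 hr.2)

/-- The border of a face along a side of a complete edge can end only at a vertex. -/
theorem mem_breaks_of_frontier {φ : L.Face} {i : Fin n} {σ : Bool} {r : ℝ}
    (hr : r ∈ Set.Icc (0 : ℝ) 1) (hout : r ∉ L.sideSet φ i σ)
    (hfr : r ∈ closure (L.sideSet φ i σ)) : r ∈ L.breaks i := by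
  by_contra hb
  have hrI := mem_Ioo_of_notMem_breaks hr hb
  -- At a point which is no vertex, the lifted face beside it also borders all nearby points; some
  -- of these border `φ`, so it lies over `φ`.
  obtain ⟨Q, hQ⟩ := exists_beside hrI hb σ 0
  obtain ⟨s, hs, hsQ⟩ := (mem_closure_iff_frequently.1 hfr).and_eventually hQ.eventually |>.exists
  rw [latticeVec_zero, add_zero] at hsQ hQ
  exact hout ⟨hrI, hQ.mono (hsQ.subset_preimage hs.2)⟩

namespace DimerEdge

theorem Icc_subset (e : L.DimerEdge) : Set.Icc e.lo e.hi ⊆ Set.Icc (0 : ℝ) 1 := by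
  have h : Set.Ioo e.lo e.hi ⊆ Set.Icc (0 : ℝ) 1 :=
    fun r hr => ⟨(e.borders hr).1.1.le, (e.borders hr).1.2.le⟩
  have := closure_minimal h isClosed_Icc
  rwa [closure_Ioo e.lt.ne] at this

theorem Icc_subset_closure (e : L.DimerEdge) :
    Set.Icc e.lo e.hi ⊆ closure (L.sideSet e.face e.idx e.side) := by
  have := closure_mono e.borders
  rwa [closure_Ioo e.lt.ne] at this

theorem lo_mem_breaks (e : L.DimerEdge) : e.lo ∈ L.breaks e.idx :=
  have h : e.lo ∈ Set.Icc e.lo e.hi := ⟨le_rfl, e.lt.le⟩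
  mem_breaks_of_frontier (e.Icc_subset h) e.lo_max (e.Icc_subset_closure h)

theorem hi_mem_breaks (e : L.DimerEdge) : e.hi ∈ L.breaks e.idx :=
  have h : e.hi ∈ Set.Icc e.lo e.hi := ⟨e.lt.le, le_rfl⟩
  mem_breaks_of_frontier (e.Icc_subset h) e.hi_max (e.Icc_subset_closure h)

end DimerEdge

/-- A portion between two vertices of a complete edge is made up of its subsegments. -/
theorem sum_subsegments {i : Fin n} {lo hi : ℝ} (hlo : lo ∈ L.breaks i)
    (hhi : hi ∈ L.breaks i) (h : lo ≤ hi) {s : Finset L.Subsegment}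
    (hs : ∀ S, S ∈ s ↔ S.idx = i ∧ lo ≤ S.lo ∧ S.hi ≤ hi) :
    ∑ S ∈ s, (S.hi - S.lo) = hi - lo := by
  classical
  -- Split off the first subsegment; the number of breaks in `[lo, hi)` drops.
  induction hk : (L.breaks i ∩ Set.Ico lo hi).ncard using Nat.strong_induction_on
    generalizing lo s with
  | _ k ih =>
  rcases h.eq_or_lt with rfl | hlt
  · have : s = ∅ := by
      refine Finset.eq_empty_of_forall_notMem fun S hS => ?_
      obtain ⟨-, h1, h2⟩ := (hs S).1 hS
      linarith [S.lt]
    simp [this]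
  · obtain ⟨S₀, hidx, hS₀⟩ := exists_subsegment_lo hlo (hlt.trans_le hhi.1.2)
    have hle : S₀.hi ≤ hi := by
      by_contra! h'
      exact S₀.consecutive hi ⟨hS₀ ▸ hlt, h'⟩ (hidx ▸ hhi)
    have hlt₀ := S₀.lt
    have hmem : S₀ ∈ s := (hs S₀).2 ⟨hidx, hS₀.ge, hle⟩
    have hrec := ih (L.breaks i ∩ Set.Ico S₀.hi hi).ncard (by
      rw [← hk]
      refine Set.ncard_lt_ncard ⟨?_, fun hsub => ?_⟩ ((finite_breaks i).inter_of_left _)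
      · exact Set.inter_subset_inter_right _ (Set.Ico_subset_Ico_left (by linarith))
      · have := (hsub ⟨hlo, le_rfl, hlt⟩).2.1
        linarith) (hidx ▸ S₀.hi_mem) hle (s := s.erase S₀) (by
      intro S
      rw [Finset.mem_erase, hs]
      constructor
      · rintro ⟨hne, h1, h2, h3⟩
        rcases Subsegment.eq_or_disjoint (h1.trans hidx.symm) with h' | h' | h'
        · exact absurd h' hne
        · linarith [S.lt]
        · exact ⟨h1, h', h3⟩
      · rintro ⟨h1, h2, h3⟩
        refine ⟨?_, h1, by linarith, h3⟩
        rintro rfl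
        linarith) rfl
    rw [← Finset.add_sum_erase s _ hmem, hrec, hS₀]
    ring

end TorusTGraph
end TGraph

namespace TGraph
namespace TorusTGraph

variable {n : ℕ} {L : TorusTGraph n}

/-! ### From marked matchings to forests -/

namespace MarkedMatching

theorem Ioo_subset (M' : L.MarkedMatching) (e : {e // e ∈ M'.1.1}) :
    Set.Ioo (M'.2.1 e).lo (M'.2.1 e).hi ⊆ Set.Ioo e.1.lo e.1.hi :=
  Set.Ioo_subset_Ioo (M'.2.2 e).2.1 (M'.2.2 e).2.2

theorem exists_dart (M' : L.MarkedMatching) (e : {e // e ∈ M'.1.1}) :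
    ∃ d : L.DualDart, d.src = e.1.face ∧ d.side = e.1.side ∧ d.seg = M'.2.1 e := by
  obtain ⟨d, h1, h2⟩ := TorusTGraph.exists_dart (M'.2.1 e) e.1.side
  refine ⟨d, DualDart.src_eq d.seg.mid_mem ?_, h2, h1⟩
  have hmid : d.seg.mid ∈ Set.Ioo (M'.2.1 e).lo (M'.2.1 e).hi := h1 ▸ d.seg.mid_mem
  rw [h1, h2, (M'.2.2 e).1, ← h1]
  exact e.1.borders (M'.Ioo_subset e hmid)

/-- The marked subsegments, indexed by the complete edges. -/
theorem exists_mark (M' : L.MarkedMatching) : ∃ m : Fin n → L.Subsegment,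
    (∀ i, (m i).idx = i) ∧ ∀ S : L.Subsegment, S = m S.idx ↔ ∃ e, M'.2.1 e = S := by
  choose e he using fun i => (M'.1.2.2 i).exists
  have hidx : ∀ i, (M'.2.1 ⟨e i, (he i).1⟩).idx = i := fun i =>
    (M'.2.2 ⟨e i, (he i).1⟩).1.trans (he i).2
  refine ⟨fun i => M'.2.1 ⟨e i, (he i).1⟩, hidx, fun S => ⟨fun h => ⟨_, h.symm⟩, ?_⟩⟩
  rintro ⟨e', rfl⟩
  have h1 := (M'.2.2 e').1
  have h2 : e' = ⟨e (M'.2.1 e').idx, (he _).1⟩ :=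
    Subtype.ext ((M'.1.2.2 e'.1.idx).unique ⟨e'.2, rfl⟩ ⟨(he _).1, (he _).2.trans h1⟩)
  exact congrArg M'.2.1 h2

theorem eq_of_seg_eq (M' : L.MarkedMatching) {e e' : {e // e ∈ M'.1.1}}
    (h : (M'.2.1 e).idx = (M'.2.1 e').idx) : e = e' := by
  rw [(M'.2.2 e).1, (M'.2.2 e').1] at h
  exact Subtype.ext ((M'.1.2.2 e'.1.idx).unique ⟨e.2, h⟩ ⟨e'.2, rfl⟩)

theorem existsUnique_dart (M' : L.MarkedMatching) (φ : L.Face) :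
    ∃! d, d ∈ M'.darts ∧ d.src = φ := by
  obtain ⟨e, ⟨he, hφ⟩, huniq⟩ := M'.1.2.1 φ
  obtain ⟨d, h1, h2, h3⟩ := M'.exists_dart ⟨e, he⟩
  refine ⟨d, ⟨⟨⟨e, he⟩, h1, h2, h3⟩, h1.trans hφ⟩, ?_⟩
  rintro d' ⟨⟨e', h1', h2', h3'⟩, hφ'⟩
  obtain rfl : e' = ⟨e, he⟩ := Subtype.ext (huniq e'.1 ⟨e'.2, h1'.symm.trans hφ'⟩)
  exact DualDart.eq_of_seg_side (h3'.trans h3.symm) (h2'.trans h2.symm)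

theorem dart_eq (M' : L.MarkedMatching) {d d' : L.DualDart} (hd : d ∈ M'.darts)
    (hd' : d' ∈ M'.darts) (h : d.seg = d'.seg) : d = d' := by
  obtain ⟨e, -, h2, h3⟩ := hd
  obtain ⟨e', -, h2', h3'⟩ := hd'
  obtain rfl := M'.eq_of_seg_eq (e := e) (e' := e') (by rw [← h3, ← h3', h])
  exact DualDart.eq_of_seg_side h (h2.trans h2'.symm)

theorem exists_dart_iff (M' : L.MarkedMatching) (S : L.Subsegment) :
    (∃ d ∈ M'.darts, d.seg = S) ↔ ∃ e, M'.2.1 e = S := by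
  constructor
  · rintro ⟨d, ⟨e, -, -, h⟩, rfl⟩
    exact ⟨e, h.symm⟩
  · rintro ⟨e, rfl⟩
    obtain ⟨d, h1, h2, h3⟩ := M'.exists_dart e
    exact ⟨d, ⟨e, h1, h2, h3⟩, h3⟩

/-- The directed dual edges of a marked matching, as a finite set. -/
def dartFinset (M' : L.MarkedMatching) : Finset L.DualDart := (Set.toFinite M'.darts).toFinset

theorem mem_dartFinset {M' : L.MarkedMatching} {d : L.DualDart} :
    d ∈ M'.dartFinset ↔ d ∈ M'.darts := Set.Finite.mem_toFinset _

/-- The darts and the edges pointing away from the marks are complementary, so the descent rules out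
null-homotopic cycles of both at once. -/
theorem dartFinset_good (M' : L.MarkedMatching) : L.IsDualForest M'.dartFinset ∧
    ∃ F, L.IsForest F ∧ L.AreDual F M'.dartFinset := by
  obtain ⟨m, hm, hmark⟩ := M'.exists_mark
  have hcomp : Complementary (awayForest m) M'.darts := by
    refine ⟨fun v => (existsUnique_awayForest hm v).exists, ?_,
      fun d hd d' hd' h => awayForest_edge_eq hd hd' h,
      fun d hd d' hd' h => M'.dart_eq hd hd' h, fun φ => (M'.existsUnique_dart φ).exists⟩
    · intro d hd d' hd' h
      refine (exists_mem_awayForest_iff hm d.seg).1 ⟨d, hd, rfl⟩ ?_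
      rw [hmark, ← M'.exists_dart_iff]
      exact ⟨d', hd', h.symm⟩
  refine ⟨⟨fun φ => ?_, fun Q hQ => hcomp.no_dual_cycle Q ?_⟩,
    (Set.toFinite (awayForest m)).toFinset, ⟨fun v => ?_, fun x hx => hcomp.no_cycle x ?_⟩,
    fun S => ?_⟩
  · simpa only [mem_dartFinset] using M'.existsUnique_dart φ
  · simpa only [mem_dartFinset] using hQ
  · simpa only [Set.Finite.mem_toFinset] using existsUnique_awayForest hm v
  · simpa only [Set.Finite.mem_toFinset] using hx
  · simp only [Set.Finite.mem_toFinset, mem_dartFinset]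
    rw [exists_mem_awayForest_iff hm, M'.exists_dart_iff, ← hmark]

/-- The forest of the dual graph given by a marked matching. -/
def toForest (M' : L.MarkedMatching) : L.GoodDualForest := ⟨M'.dartFinset, M'.dartFinset_good⟩

theorem coe_toForest (M' : L.MarkedMatching) : (M'.toForest.1 : Set L.DualDart) = M'.darts :=
  Set.Finite.coe_toFinset _

/-- A dart remembers its mark, and also the dimer edge: face, side, complete edge and one interior
point determine the maximal portion. -/
theorem exists_edge_of_darts_subset {M' N' : L.MarkedMatching} (h : M'.darts ⊆ N'.darts)
    (e : {e // e ∈ M'.1.1}) : ∃ e' : {e // e ∈ N'.1.1}, e'.1 = e.1 ∧ N'.2.1 e' = M'.2.1 e := by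
  obtain ⟨d, h1, h2, h3⟩ := M'.exists_dart e
  obtain ⟨e', h1', h2', h3'⟩ := h ⟨e, h1, h2, h3⟩
  have hseg : N'.2.1 e' = M'.2.1 e := h3'.symm.trans h3
  refine ⟨e', ?_, hseg⟩
  have hmem' := N'.Ioo_subset e' (N'.2.1 e').mid_mem
  rw [hseg] at hmem'
  refine DimerEdge.eq_of_mem (h1'.symm.trans h1) ?_ (h2'.symm.trans h2) hmem'
    (M'.Ioo_subset e (M'.2.1 e).mid_mem)
  rw [← (M'.2.2 e).1, ← (N'.2.2 e').1, hseg]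

theorem toForest_injective : Function.Injective (toForest (L := L)) := by
  intro M' N' h
  have hd : M'.darts = N'.darts := by rw [← coe_toForest, ← coe_toForest, h]
  have hM : M'.1 = N'.1 := by
    apply Subtype.ext
    ext e
    constructor
    · intro he
      obtain ⟨e', h1, -⟩ := exists_edge_of_darts_subset hd.le ⟨e, he⟩
      have h1 : e'.1 = e := h1
      exact h1 ▸ e'.2
    · intro he
      obtain ⟨e', h1, -⟩ := exists_edge_of_darts_subset hd.ge ⟨e, he⟩
      have h1 : e'.1 = e := h1
      exact h1 ▸ e'.2
  obtain ⟨M, m⟩ := M'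
  obtain ⟨N, m'⟩ := N'
  simp only at hM
  subst hM
  congr 1
  apply Subtype.ext
  funext e
  obtain ⟨e', h1, h2⟩ := exists_edge_of_darts_subset hd.le e
  obtain rfl : e' = e := Subtype.ext h1
  exact h2.symm

theorem toForest_surjective : Function.Surjective (toForest (L := L)) := by
  classical
  rintro ⟨F', hF', F, hF, hdual⟩
  -- The unique subsegment unused by `F` is the only one that `F'` crosses on this complete edge,
  -- and `F'` crosses it in one direction only.
  have hidx : ∀ i, ∃! d, d ∈ F' ∧ d.seg.idx = i := by
    intro i
    obtain ⟨S, ⟨hSi, hS⟩, huniq⟩ := hF.exists_unique_unused i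
    rw [hdual S, not_not] at hS
    obtain ⟨d, hd, rfl⟩ := hS
    refine ⟨d, ⟨hd, hSi⟩, ?_⟩
    rintro d' ⟨hd', hdi'⟩
    refine hF'.dart_eq hd' hd (huniq _ ⟨hdi', ?_⟩)
    rw [hdual, not_not]
    exact ⟨d', hd', rfl⟩
  choose E hface hEidx hside hlo hhi using fun d : L.DualDart => d.exists_dimerEdge
  let M : L.PerfectMatching := ⟨F'.image E, by
    constructor
    · intro φ
      obtain ⟨d, ⟨hd, hdφ⟩, huniq⟩ := hF'.1 φ
      refine ⟨E d, ⟨Finset.mem_image_of_mem E hd, (hface d).trans hdφ⟩, ?_⟩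
      rintro e ⟨he, heφ⟩
      obtain ⟨d', hd', rfl⟩ := Finset.mem_image.1 he
      rw [huniq d' ⟨hd', (hface d').symm.trans heφ⟩]
    · intro i
      obtain ⟨d, ⟨hd, hdi⟩, huniq⟩ := hidx i
      refine ⟨E d, ⟨Finset.mem_image_of_mem E hd, (hEidx d).trans hdi⟩, ?_⟩
      rintro e ⟨he, hei⟩
      obtain ⟨d', hd', rfl⟩ := Finset.mem_image.1 he
      rw [huniq d' ⟨hd', (hEidx d').symm.trans hei⟩]⟩
  have hchoice : ∀ e : {e // e ∈ M.1}, ∃ d ∈ F', E d = e.1 := fun e => Finset.mem_image.1 e.2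
  choose D hD hED using hchoice
  let m : Marking M := ⟨fun e => (D e).seg, fun e => by
    have h1 := hEidx (D e)
    have h2 := hlo (D e)
    have h3 := hhi (D e)
    rw [hED] at h1 h2 h3
    exact ⟨h1.symm, h2, h3⟩⟩
  refine ⟨⟨M, m⟩, Subtype.ext (Finset.coe_injective
    ((coe_toForest ⟨M, m⟩).trans (Set.ext fun d => ?_)))⟩
  constructor
  · rintro ⟨e, -, h2, h3⟩
    have : d = D e := by
      refine DualDart.eq_of_seg_side h3 (h2.trans ?_)
      rw [← hside (D e), hED]
    rw [this]
    exact hD e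
  · intro hd
    have he : E d ∈ M.1 := Finset.mem_image_of_mem E hd
    refine ⟨⟨E d, he⟩, (hface d).symm, (hside d).symm, ?_⟩
    have hdD : D ⟨E d, he⟩ = d := by
      -- Two darts of `F'` in the same dimer edge leave the same face, hence coincide.
      refine (hF'.1 d.src).unique ⟨hD _, ?_⟩ ⟨hd, rfl⟩
      rw [← hface, hED, hface]
    exact (congrArg DualDart.seg hdD).symm

theorem dualForestWeight_toForest (M' : L.MarkedMatching) :
    dualForestWeight M'.toForest.1 = M'.weight := by
  choose D h1 h2 h3 using M'.exists_dart
  refine (Finset.prod_bij (fun e _ => D e) ?_ ?_ ?_ ?_).symm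
  · exact fun e _ => mem_dartFinset.2 ⟨e, h1 e, h2 e, h3 e⟩
  · intro e _ e' _ h
    exact M'.eq_of_seg_eq (by rw [← h3, ← h3, h])
  · intro d hd
    obtain ⟨e, h1', h2', h3'⟩ := mem_dartFinset.1 hd
    exact ⟨e, Finset.mem_attach _ _,
      DualDart.eq_of_seg_side ((h3 e).trans h3'.symm) ((h2 e).trans h2'.symm)⟩
  · intro e _
    rw [h3]

end MarkedMatching

instance : Finite L.MarkedMatching := by
  refine Finite.of_injective (fun M' : L.MarkedMatching => M'.toForest.1) ?_
  exact fun M' N' h => MarkedMatching.toForest_injective (Subtype.ext h)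

/-! ### Weights -/

/-- The normalizing constant of the transition probabilities at a vertex. -/
def outWeight (v : L.Vertex) : ℝ :=
  ∑ᶠ (d : L.TEdge) (_ : d.src = v), d.seg.length⁻¹

theorem exists_src_eq (v : L.Vertex) : ∃ d : L.TEdge, d.src = v := by
  obtain ⟨i, r, hr, hv⟩ := exists_position v.2
  have hrb : r ∈ L.breaks i := ⟨⟨hr.1.le, hr.2.le⟩, hv ▸ v.2⟩
  obtain ⟨S, rfl, rfl⟩ := exists_subsegment_lo hrb hr.2
  exact ⟨⟨S, true, by simpa using hr⟩, TEdge.src_eq hv rfl rfl⟩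

theorem outWeight_pos (v : L.Vertex) : 0 < outWeight v := by
  have h : outWeight v = ∑ d ∈ (Set.toFinite {d : L.TEdge | d.src = v}).toFinset,
      d.seg.length⁻¹ := finsum_mem_eq_finite_toFinset_sum _ _
  rw [h]
  refine Finset.sum_pos (fun d _ => inv_pos.2 d.seg.length_pos) ?_
  obtain ⟨d, hd⟩ := exists_src_eq v
  exact ⟨d, (Set.Finite.mem_toFinset _).2 hd⟩

/-- The weights of dual forests are proportional. -/
theorem exists_forestWeight_eq (L : TorusTGraph n) : ∃ c : ℝ, 0 < c ∧
    ∀ (F : Finset L.TEdge) (F' : Finset L.DualDart), L.IsForest F → L.IsDualForest F' →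
      L.AreDual F F' → forestWeight F = c * dualForestWeight F' := by
  classical
  have := Fintype.ofFinite L.Subsegment
  have := Fintype.ofFinite L.Vertex
  -- The inverse lengths of all subsegments, times the normalization at each vertex, which every
  -- forest leaves exactly once.
  refine ⟨(∏ S : L.Subsegment, S.length⁻¹) * ∏ v : L.Vertex, (outWeight v)⁻¹, ?_, ?_⟩
  · exact mul_pos (Finset.prod_pos fun S _ => inv_pos.2 S.length_pos)
      (Finset.prod_pos fun v _ => inv_pos.2 (outWeight_pos v))
  · intro F F' hF hF' hdual
    have h1 : forestWeight F =
        (∏ d ∈ F, d.seg.length⁻¹) * ∏ d ∈ F, (outWeight d.src)⁻¹ := by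
      rw [← Finset.prod_mul_distrib]
      exact Finset.prod_congr rfl fun d _ => div_eq_mul_inv _ _
    have h2 : ∏ d ∈ F, (outWeight d.src)⁻¹ = ∏ v : L.Vertex, (outWeight v)⁻¹ := by
      refine Finset.prod_bij (fun d _ => d.src) (fun _ _ => Finset.mem_univ _) ?_ ?_
        (fun _ _ => rfl)
      · exact fun d hd d' hd' h => (hF.1 d'.src).unique ⟨hd, h⟩ ⟨hd', rfl⟩
      · intro v _
        obtain ⟨d, ⟨hd, hdv⟩, -⟩ := hF.1 v
        exact ⟨d, hd, hdv⟩
    have h3 : ∏ d ∈ F, d.seg.length⁻¹ = ∏ S ∈ F.image TEdge.seg, S.length⁻¹ :=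
      (Finset.prod_image (f := fun S : L.Subsegment => S.length⁻¹)
        fun d hd d' hd' h => hF.edge_eq hd hd' h).symm
    have h4 : dualForestWeight F' = ∏ S ∈ F'.image DualDart.seg, S.length :=
      (Finset.prod_image fun d hd d' hd' h => hF'.dart_eq hd hd' h).symm
    have h5 : F'.image DualDart.seg = (F.image TEdge.seg)ᶜ := by
      ext S
      rw [Finset.mem_compl, Finset.mem_image, Finset.mem_image, hdual S, not_not]
    have h6 : ∏ S ∈ (F.image TEdge.seg)ᶜ, S.length ≠ 0 :=
      (Finset.prod_pos fun S _ => S.length_pos).ne'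
    rw [h1, h2, h3, h4, h5, ← Finset.prod_mul_prod_compl (F.image TEdge.seg),
      Finset.prod_inv_distrib (s := (F.image TEdge.seg)ᶜ)]
    field_simp

/-- The weight of a perfect matching is the sum of the weights of its markings. -/
theorem PerfectMatching.weight_eq_finsum (M : L.PerfectMatching) :
    M.weight = ∑ᶠ m : Marking M, MarkedMatching.weight ⟨M, m⟩ := by
  classical
  have := Fintype.ofFinite L.Subsegment
  let t : {e // e ∈ M.1} → Finset L.Subsegment := fun e =>
    Finset.univ.filter fun S => S.idx = e.1.idx ∧ e.1.lo ≤ S.lo ∧ S.hi ≤ e.1.hi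
  have hedge : ∀ e : {e // e ∈ M.1}, e.1.weight = ∑ S ∈ t e, S.length := by
    intro e
    have h := sum_subsegments e.1.lo_mem_breaks e.1.hi_mem_breaks e.1.lt.le (s := t e)
      (fun S => by simp [t])
    rw [DimerEdge.weight, ← h, Finset.sum_mul]
    refine Finset.sum_congr rfl fun S hS => ?_
    rw [Subsegment.length, (Finset.mem_filter.1 hS).2.1]
  have h1 : M.weight = ∏ e ∈ M.1.attach, e.1.weight := (Finset.prod_attach M.1 _).symm
  rw [h1, Finset.prod_congr rfl fun e _ => hedge e]
  -- Distributing the product over the sums gives one term for each choice of a subsegment in every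
  -- matching edge, that is, for each marking.
  rw [← Finset.univ_eq_attach, Finset.prod_univ_sum]
  have hset : (Fintype.piFinset t : Set ({e // e ∈ M.1} → L.Subsegment)) =
      {m | ∀ e, (m e).idx = e.1.idx ∧ e.1.lo ≤ (m e).lo ∧ (m e).hi ≤ e.1.hi} := by
    ext m
    simp [t]
  rw [← finsum_mem_coe_finset, hset, ← finsum_set_coe_eq_finsum_mem]
  rfl

end TorusTGraph
end TGraph

end

theorem mainTheorem2 {n : ℕ} (L : TGraph.TorusTGraph n) :
    ∃ Φ : L.MarkedMatching ≃ L.GoodDualForest,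
      (∀ M' : L.MarkedMatching, ((Φ M').1 : Set L.DualDart) = M'.darts) ∧
      (∀ M' : L.MarkedMatching, TGraph.TorusTGraph.dualForestWeight (Φ M').1 = M'.weight) ∧
      (∃ c : ℝ, 0 < c ∧ ∀ (M' : L.MarkedMatching) (F : Finset L.TEdge),
        L.IsForest F → L.AreDual F (Φ M').1 →
          TGraph.TorusTGraph.forestWeight F = c * M'.weight) ∧
      Finite L.MarkedMatching ∧
      (∀ M : L.PerfectMatching,
        M.weight = ∑ᶠ m : TGraph.TorusTGraph.Marking M,
          TGraph.TorusTGraph.dualForestWeight (Φ ⟨M, m⟩).1) := by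
  obtain ⟨c, hc, hweight⟩ := L.exists_forestWeight_eq
  refine ⟨Equiv.ofBijective _ ⟨TGraph.TorusTGraph.MarkedMatching.toForest_injective,
    TGraph.TorusTGraph.MarkedMatching.toForest_surjective⟩, fun M' => M'.coe_toForest,
    fun M' => M'.dualForestWeight_toForest, ⟨c, hc, fun M' F hF hdual => ?_⟩, inferInstance,
    fun M => ?_⟩
  · rw [← M'.dualForestWeight_toForest]
    exact hweight F M'.toForest.1 hF M'.toForest.2.1 hdual
  · rw [M.weight_eq_finsum]
    exact finsum_congr fun m =>
      (TGraph.TorusTGraph.MarkedMatching.dualForestWeight_toForest ⟨M, m⟩).symm
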